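/- Let $n,l\in\mathbb N$, $p,r\in(0,\infty]$, $\sigma_1\in(0,\infty]$, $\sigma_2=p$, $\alpha_1,\alpha_2\in\mathbb R$, $\alpha_3\ge 0$. For $k\in\mathbb N_0$, $m\in\mathbb Z^n$ put $Q_{k,m}=\prod_{i=1}^n\bigl(\tfrac{m_i}{2^k},\tfrac{m_i+1}{2^k}\bigr)$, $\widetilde Q_{k,m}=\prod_{i=1}^n\bigl[\tfrac{m_i}{2^k},\tfrac{m_i+1}{2^k}\bigr)$. Let $t_k:\mathbb R^n\to(0,\infty)$, $k\in\mathbb N_0$, be measurable with $t_k\in L_p^{\rm loc}(\mathbb R^n)$, and set $t_{k,m}=\|t_k|L_p(Q_{k,m})\|$, $\overline t_k=2^{kn/p}\sum_m t_{k,m}\chi_{\widetilde Q_{k,m}}$ (throughout, expressions with an infinite exponent are read with essential suprema and suprema, and $2^{kn/\infty}=1$). Assume $\{t_k\}\in X^{\alpha_3}_{\alpha,\sigma,p}$, that is, there are $c_1,c_2>0$ such that for all $0\le k\le j$ and $m\in\mathbb Z^n$ $$\Bigl(2^{kn}\int_{Q_{k,m}}\overline t_k^{\,p}\Bigr)^{1/p}\Bigl(2^{kn}\int_{Q_{k,m}}\overline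 t_j^{\,-\sigma_1}\Bigr)^{1/\sigma_1}\le c_1 2^{\alpha_1(k-j)},\qquad \Bigl(2^{kn}\int_{Q_{k,m}}\overline t_k^{\,p}\Bigr)^{-1/p}\Bigl(2^{kn}\int_{Q_{k,m}}\overline t_j^{\,\sigma_2}\Bigr)^{1/\sigma_2}\le c_2 2^{\alpha_2(j-k)},$$ and $0<t_{k,m}\le 2^{\alpha_3}t_{k,\widetilde m}$ whenever $|m_i-\widetilde m_i|\le 1$ for $i=1,\dots,n$. For $\varphi\in L_r^{\rm loc}(\mathbb R^n)$ let $\Delta^l(h)\varphi(x)=\sum_{j=0}^l(-1)^{l+j}\binom lj\varphi(x+jh)$ and $$\delta^l_r(Q_{k,m})\varphi=\Bigl(2^{2kn}\int_{(-2^{-k},2^{-k})^n}\int_{Q_{k,m}}|\Delta^l(h)\varphi(x)|^r\,dx\,dh\Bigr)^{1/r}.$$ Let $N^{l}$ be the B-spline of degree $l$ with knots $0,1,\dots,l+1$, let $N^l_{k,m}(x)=\prod_{i=1}^nN^l(2^kx_i-m_i)$, and let $\Sigma^l_k$ be the set of all splines $\sum_{m\in\mathbb Z^n}\beta_mN^l_{k,m}$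 with $\beta_m\in\mathbb R$. Put $$s^{l+1}_k=\inf_{S\in\Sigma^l_k}\Bigl(\sum_{m\in\mathbb Z^n}t_{k,m}^p\,2^{knp/r}\|\varphi-S|L_r(Q_{k,m})\|^p\Bigr)^{1/p}\ (k\in\mathbb N_0),\qquad s^{l+1}_{-1}=\Bigl(\sum_{m\in\mathbb Z^n}t_{0,m}^p\|\varphi|L_r(Q_{0,m})\|^p\Bigr)^{1/p}.$$ Then there is a constant $C>0$, depending only on $n,l,p,r,\sigma_1,\alpha_1,\alpha_2,\alpha_3,c_1,c_2$ (and not on $\varphi$, $k$ or $\mu$), such that for all $k\in\mathbb N_0$ and all $0<\mu\le\min\{1,r,p\}$ $$\Bigl(\sum_{m\in\mathbb Z^n}t_{k,m}^p\bigl[\delta^l_r(Q_{k,m})\varphi\bigr]^p\Bigr)^{1/p}\le C\,2^{-k(l-\alpha_2)}\Bigl(\sum_{j=-1}^k2^{j\mu(l-\alpha_2)}\bigl(s_j^{l+1}\bigr)^\mu\Bigr)^{1/\mu}$$ (both sides may be infinite). -/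

import Mathlib

open MeasureTheory
open scoped ENNReal NNReal

namespace VarSmooth

noncomputable section

/-- Local `L_p`, `0 < p ≤ ∞`: measurable with finite `L_p` (quasi-)norm on every compact set. -/
def LocLp {n : ℕ} (f : (Fin n → ℝ) → ℝ) (p : ℝ≥0∞) : Prop :=
  ∀ K : Set (Fin n → ℝ), IsCompact K → MemLp f p (volume.restrict K)

/-- The open cube with lower corner `a` and side length `s`. -/
def openCube {n : ℕ} (a : Fin n → ℝ) (s : ℝ) : Set (Fin n → ℝ) :=
  Set.univ.pi fun i => Set.Ioo (a i) (a i + s)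

/-- The lower corner `m / 2^k` of the dyadic cubes with index `(k, m)`. -/
def corner {n : ℕ} (k : ℕ) (m : Fin n → ℤ) : Fin n → ℝ := fun i => (m i : ℝ) / 2 ^ k

/-- The open dyadic cube `Q_{k,m} = ∏ (m_i / 2^k, (m_i + 1) / 2^k)`. -/
def dyadicCube {n : ℕ} (k : ℕ) (m : Fin n → ℤ) : Set (Fin n → ℝ) :=
  openCube (corner k m) ((2 ^ k : ℝ)⁻¹)

/-- The half-open dyadic cube `∏ [m_i / 2^k, (m_i + 1) / 2^k)`. -/
def dyadicCubeHalfOpen {n : ℕ} (k : ℕ) (m : Fin n → ℤ) : Set (Fin n → ℝ) :=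
  Set.univ.pi fun i => Set.Ico ((m i : ℝ) / 2 ^ k) (((m i : ℝ) + 1) / 2 ^ k)

/-- The factor `2^{kn/p}`, equal to `1` for `p = ∞` (then `p.toReal = 0` and `x / 0 = 0`). -/
def scale (n k : ℕ) (p : ℝ≥0∞) : ℝ≥0∞ := (2 : ℝ≥0∞) ^ (((k : ℝ) * n) / p.toReal)

/-- The `l_p` (quasi-)norm of a family of elements of `[0, ∞]`, `0 < p ≤ ∞`. -/
def seqNorm {ι : Type*} (p : ℝ≥0∞) (a : ι → ℝ≥0∞) : ℝ≥0∞ :=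
  if p = ∞ then ⨆ i, a i else (∑' i, a i ^ p.toReal) ^ (1 / p.toReal)

/-- `δ^l_r(Q)φ = ( s^{-2n} ∫_{s I^n} ∫_Q |Δ^l(h)φ(x)|^r dx dh )^{1/r}` for the cube `Q` with lower
corner `a` and side length `s`, where `I^n = (-1,1)^n` and
`Δ^l(h)φ(x) = ∑_{j=0}^l (-1)^{l+j} C(l,j) φ(x + j h)` is the iterated forward difference; for
`r = ∞` it is the essential supremum over `(h, x) ∈ s I^n × Q` (the factor in front is then `1`). -/
def delta {n : ℕ} (l : ℕ) (r : ℝ≥0∞) (a : Fin n → ℝ) (s : ℝ) (φ : (Fin n → ℝ) → ℝ) : ℝ≥0∞ :=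
  ENNReal.ofReal s ^ (-(2 * (n : ℝ)) / r.toReal) *
    eLpNorm (fun q : (Fin n → ℝ) × (Fin n → ℝ) => (fwdDiff q.1)^[l] φ q.2) r
      ((volume.restrict (Set.univ.pi fun _ : Fin n => Set.Ioo (-s) s)).prod
        (volume.restrict (openCube a s)))

/-- `t_{k,m} = ‖t_k | L_p(Q_{k,m})‖`. -/
def assoc {n : ℕ} (p : ℝ≥0∞) (t : ℕ → (Fin n → ℝ) → ℝ) (k : ℕ) (m : Fin n → ℤ) : ℝ≥0∞ :=
  eLpNorm (t k) p (volume.restrict (dyadicCube k m))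

/-- The `p`-associated step weight `2^{kn/p} ∑_m t_{k,m} χ(x)`, `χ` the indicator of the half-open
dyadic cube with index `(k, m)`. -/
def assocWeight {n : ℕ} (p : ℝ≥0∞) (t : ℕ → (Fin n → ℝ) → ℝ) (k : ℕ) (x : Fin n → ℝ) : ℝ≥0∞ :=
  scale n k p * ∑' m : Fin n → ℤ, (dyadicCubeHalfOpen k m).indicator (fun _ => assoc p t k m) x

/-- `(2^{kn} ∫_{Q_{k,m}} f^q)^{1/q}`, the essential supremum over `Q_{k,m}` for `q = ∞`. -/
def cubeMean {n : ℕ} (k : ℕ) (m : Fin n → ℤ) (q : ℝ≥0∞) (f : (Fin n → ℝ) → ℝ≥0∞) : ℝ≥0∞ :=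
  scale n k q * eLpNorm f q (volume.restrict (dyadicCube k m))

/-- The weight class `X^{α₃}_{α,σ,p}`, `α = (α₁, α₂)`, `σ = (σ₁, σ₂)`, with the constants `c₁, c₂`
of its two integral conditions displayed. A weight sequence belongs to the class if this holds for
some `c₁, c₂ > 0`. -/
structure IsXClass {n : ℕ} (α₁ α₂ α₃ : ℝ) (σ₁ σ₂ p : ℝ≥0∞) (c₁ c₂ : ℝ)
    (t : ℕ → (Fin n → ℝ) → ℝ) : Prop where
  pos : ∀ k x, 0 < t k x
  admissible : ∀ k, LocLp (t k) p
  lower : ∀ (k j : ℕ) (m : Fin n → ℤ), k ≤ j →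
    cubeMean k m p (assocWeight p t k) * cubeMean k m σ₁ (fun x => (assocWeight p t j x)⁻¹)
      ≤ ENNReal.ofReal c₁ * (2 : ℝ≥0∞) ^ (α₁ * ((k : ℝ) - j))
  upper : ∀ (k j : ℕ) (m : Fin n → ℤ), k ≤ j →
    (cubeMean k m p (assocWeight p t k))⁻¹ * cubeMean k m σ₂ (assocWeight p t j)
      ≤ ENNReal.ofReal c₂ * (2 : ℝ≥0∞) ^ (α₂ * ((j : ℝ) - k))
  assoc_pos : ∀ (k : ℕ) (m : Fin n → ℤ), 0 < assoc p t k m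
  neighbour : ∀ (k : ℕ) (m m' : Fin n → ℤ), (∀ i, |m i - m' i| ≤ 1) →
    assoc p t k m ≤ (2 : ℝ≥0∞) ^ α₃ * assoc p t k m'

/-- The B-spline of degree `d` with knots `0, 1, …, d + 1`: the divided difference over the knots of
the truncated power `(t - ·)_+^d`, normalized so that the integer translates sum to `1`. -/
def bSpline (d : ℕ) (t : ℝ) : ℝ :=
  ((d.factorial : ℝ))⁻¹ * ∑ i ∈ Finset.range (d + 2),
    (-1) ^ i * ((d + 1).choose i : ℝ) * (if (i : ℝ) ≤ t then (t - i) ^ d else 0)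

/-- The tensor-product B-spline `N^d_{k,m}(x) = ∏ N^d(2^k (x_i - m_i / 2^k))`. -/
def tensorSpline {n : ℕ} (d k : ℕ) (m : Fin n → ℤ) (x : Fin n → ℝ) : ℝ :=
  ∏ i, bSpline d (2 ^ k * (x i - (m i : ℝ) / 2 ^ k))

/-- The set `Σ^d_k` of all splines `∑_m β_m N^d_{k,m}` with arbitrary real coefficients (at every
point only finitely many terms are nonzero). -/
def splineSpace (n d k : ℕ) : Set ((Fin n → ℝ) → ℝ) :=
  {S | ∃ β : (Fin n → ℤ) → ℝ, ∀ x, S x = ∑' m : Fin n → ℤ, β m * tensorSpline d k m x}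

/-- The weighted best approximation `s^l_k(φ)_{r,p}`, `k ≥ 0`, by splines of order `l`
(degree `l - 1`): the infimum over `S ∈ Σ^{l-1}_k` of
`( ∑_m t_{k,m}^p (2^{kn/r} ‖φ - S | L_r(Q_{k,m})‖)^p )^{1/p}`. -/
def splineApprox {n : ℕ} (l : ℕ) (r p : ℝ≥0∞) (t : ℕ → (Fin n → ℝ) → ℝ) (φ : (Fin n → ℝ) → ℝ)
    (k : ℕ) : ℝ≥0∞ :=
  ⨅ S ∈ splineSpace n (l - 1) k, seqNorm p fun m : Fin n → ℤ =>
    assoc p t k m *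
      (scale n k r * eLpNorm (fun x => φ x - S x) r (volume.restrict (dyadicCube k m)))

/-- The term `s_{-1}(φ)_{r,p} = ( ∑_m t_{0,m}^p ‖φ | L_r(Q_{0,m})‖^p )^{1/p}`. -/
def splineApproxInit {n : ℕ} (r p : ℝ≥0∞) (t : ℕ → (Fin n → ℝ) → ℝ) (φ : (Fin n → ℝ) → ℝ) :
    ℝ≥0∞ :=
  seqNorm p fun m : Fin n → ℤ =>
    assoc p t 0 m * eLpNorm φ r (volume.restrict (dyadicCube 0 m))

end

end VarSmooth

namespace VarSmooth

/-! ### Quasi-norm inequalities -/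

/-! Choose a near-best spline `S_j` at every level and telescope: `φ = (φ - S_k) + S_0 + ∑_{1 ≤ j ≤
k} (S_j - S_{j-1})`. The `l`-th difference of the remainder `φ - S_k` is bounded by the size of the
remainder on an enlarged cube (`delta_rpow_le`), and the neighbour condition turns this into the
approximation error of level `k`.

An increment of level `j` is locally a combination of finitely many B-splines of degree `l`, whose
`l`-th differences with step `h` are `O((2^j |h|)^l)`. Since `|h| ≤ 2^{-k}`, this gains `2^{l(j-k)}`
(`exists_delta_le_of_hasLocalExpansion`). The second weight condition, with `σ₂ = p`, costs
`2^{α₂(k-j)}` when weighted sums over cubes of level `k` are gathered into cubes of level `j`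
(`IsXClass.seqNorm_parent_le`). The net factor is `2^{-(k-j)(l-α₂)}`. Finally `S_j - S_{j-1} = (φ -
S_{j-1}) - (φ - S_j)` and `S_0 = φ - (φ - S_0)` return everything to the errors `s_j` and to
`s_{-1}`.

For small `r` or `p` the triangle inequality fails, but it holds for `μ`-th powers of the
quasi-norms when `μ ≤ min {1, r, p}` (`eLpNorm_rpow_le_sum`, `seqNorm_rpow_le_sum`). To keep the
constant independent of `μ`, the argument is run for `ν = min {1, r, p}` only; smaller `μ` follow
from `rpow_sum_rpow_antitone`. -/

theorem rpow_sum_le_sum_rpow {ι : Type*} (s : Finset ι) (a : ι → ℝ≥0∞) {μ : ℝ} (hμ : 0 < μ)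
    (hμ1 : μ ≤ 1) : (∑ i ∈ s, a i) ^ μ ≤ ∑ i ∈ s, a i ^ μ :=
  Finset.le_sum_of_subadditive (fun x : ℝ≥0∞ => x ^ μ) (by simp [hμ])
    (fun x y => ENNReal.rpow_add_le_add_rpow x y hμ.le hμ1) s a

theorem rpow_sum_rpow_antitone {ι : Type*} (s : Finset ι) (a : ι → ℝ≥0∞) {μ ν : ℝ} (hμ : 0 < μ)
    (hμν : μ ≤ ν) : (∑ i ∈ s, a i ^ ν) ^ (1 / ν) ≤ (∑ i ∈ s, a i ^ μ) ^ (1 / μ) := by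
  have hν : 0 < ν := hμ.trans_le hμν
  have h := rpow_sum_le_sum_rpow s (fun i => a i ^ ν) (div_pos hμ hν) ((div_le_one hν).2 hμν)
  simp only [← ENNReal.rpow_mul, mul_div_cancel₀ μ hν.ne'] at h
  calc (∑ i ∈ s, a i ^ ν) ^ (1 / ν) = ((∑ i ∈ s, a i ^ ν) ^ (μ / ν)) ^ (1 / μ) := by
        rw [← ENNReal.rpow_mul]; congr 1; field_simp
    _ ≤ _ := ENNReal.rpow_le_rpow h (by positivity)

/-- The `μ`-th power of the `L_p` quasi-norm of `g` is the `L_{p/μ}` norm of `g ^ μ`, and `p / μ ≥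
1`, so Minkowski's inequality applies. Values in `[0, ∞]` let the same statement serve sequences. -/
theorem eLpNorm_rpow_le_sum {X ι : Type*} [MeasurableSpace X] {ν : Measure X} {p : ℝ≥0∞} {μ : ℝ}
    (hμ : 0 < μ) (hμp : ENNReal.ofReal μ ≤ p) (s : Finset ι) (F : X → ℝ≥0∞)
    (f : ι → X → ℝ≥0∞) (hf : ∀ i ∈ s, AEMeasurable (f i) ν)
    (hle : ∀ᵐ x ∂ν, F x ^ μ ≤ ∑ i ∈ s, f i x ^ μ) :
    eLpNorm F p ν ^ μ ≤ ∑ i ∈ s, eLpNorm (f i) p ν ^ μ := by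
  have hμ0 : ENNReal.ofReal μ ≠ 0 := by simpa using hμ
  have key : ∀ g : X → ℝ≥0∞,
      eLpNorm g p ν ^ μ = eLpNorm (fun x => g x ^ μ) (p / ENNReal.ofReal μ) ν := by
    intro g
    have := eLpNorm_enorm_rpow (p := p / ENNReal.ofReal μ) (μ := ν) g hμ
    rw [ENNReal.div_mul_cancel hμ0 ENNReal.ofReal_ne_top] at this
    simpa using this.symm
  simp only [key]
  calc _ ≤ eLpNorm (∑ i ∈ s, fun x => f i x ^ μ) (p / ENNReal.ofReal μ) ν := by
        refine eLpNorm_mono_enorm_ae ?_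
        filter_upwards [hle] with x hx
        simpa using hx
    _ ≤ _ := by
        refine eLpNorm_sum_le (fun i hi => ((hf i hi).pow_const μ).aestronglyMeasurable) ?_
        rw [ENNReal.le_div_iff_mul_le (Or.inl hμ0) (Or.inl ENNReal.ofReal_ne_top)]
        simpa using hμp

theorem eLpNorm_real_rpow_le_sum {X ι : Type*} [MeasurableSpace X] {ν : Measure X} {p : ℝ≥0∞}
    {μ : ℝ} (hμ : 0 < μ) (hμ1 : μ ≤ 1) (hμp : ENNReal.ofReal μ ≤ p) (s : Finset ι) (F : X → ℝ)
    (f : ι → X → ℝ) (hf : ∀ i ∈ s, AEStronglyMeasurable (f i) ν)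
    (hle : ∀ᵐ x ∂ν, ‖F x‖ₑ ≤ ∑ i ∈ s, ‖f i x‖ₑ) :
    eLpNorm F p ν ^ μ ≤ ∑ i ∈ s, eLpNorm (f i) p ν ^ μ := by
  have := eLpNorm_rpow_le_sum hμ hμp s (fun x => ‖F x‖ₑ) (fun i x => ‖f i x‖ₑ)
    (fun i hi => (hf i hi).enorm) (by
      filter_upwards [hle] with x hx
      exact (ENNReal.rpow_le_rpow hx hμ.le).trans (rpow_sum_le_sum_rpow s _ hμ hμ1))
  simpa only [eLpNorm_enorm] using this

theorem eLpNorm_sub_rpow_le {X : Type*} [MeasurableSpace X] {ν : Measure X} {p : ℝ≥0∞}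
    {μ : ℝ} (hμ : 0 < μ) (hμ1 : μ ≤ 1) (hμp : ENNReal.ofReal μ ≤ p) {f g : X → ℝ}
    (hf : AEStronglyMeasurable f ν) (hg : AEStronglyMeasurable g ν) :
    eLpNorm (fun x => f x - g x) p ν ^ μ ≤ eLpNorm f p ν ^ μ + eLpNorm g p ν ^ μ := by
  have := eLpNorm_real_rpow_le_sum hμ hμ1 hμp (Finset.univ : Finset Bool) (fun x => f x - g x)
    (fun b => if b then f else g) (by rintro (_ | _) _ <;> simpa)
    (Filter.Eventually.of_forall fun x => by simpa using! enorm_sub_le (a := f x) (b := g x))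
  simpa using this

section seqNorm

variable {ι : Type*} {p : ℝ≥0∞}

/-- With the counting measure on the full σ-algebra measurability is automatic, and the inequalities
for `eLpNorm` pass to sequences for all `p` at once. -/
theorem seqNorm_eq_eLpNorm (hp : p ≠ 0) (a : ι → ℝ≥0∞) :
    seqNorm p a = @eLpNorm ι ℝ≥0∞ _ ⊤ a p (@Measure.count ι ⊤) := by
  let _ : MeasurableSpace ι := ⊤
  unfold seqNorm
  split_ifs with h
  · subst h; simp [eLpNormEssSup_count]
  · rw [eLpNorm_eq_lintegral_rpow_enorm_toReal hp h]; simp [lintegral_count]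

theorem seqNorm_mono (hp : p ≠ 0) {a b : ι → ℝ≥0∞} (h : ∀ i, a i ≤ b i) :
    seqNorm p a ≤ seqNorm p b := by
  rw [seqNorm_eq_eLpNorm hp, seqNorm_eq_eLpNorm hp]
  let _ : MeasurableSpace ι := ⊤
  exact eLpNorm_mono_enorm fun i => by simpa using h i

theorem seqNorm_rpow_le_sum {κ : Type*} {μ : ℝ} (hμ : 0 < μ) (hμp : ENNReal.ofReal μ ≤ p)
    (s : Finset κ) (F : ι → ℝ≥0∞) (f : κ → ι → ℝ≥0∞) (hle : ∀ x, F x ^ μ ≤ ∑ i ∈ s, f i x ^ μ) :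
    seqNorm p F ^ μ ≤ ∑ i ∈ s, seqNorm p (f i) ^ μ := by
  have hp : p ≠ 0 := by
    rintro rfl; simp at hμp; linarith
  simp only [seqNorm_eq_eLpNorm hp]
  let _ : MeasurableSpace ι := ⊤
  exact eLpNorm_rpow_le_sum hμ hμp s F f (fun i _ => measurable_from_top.aemeasurable)
    (Filter.Eventually.of_forall hle)

theorem seqNorm_const_mul (hp : p ≠ 0) (c : ℝ≥0∞) (a : ι → ℝ≥0∞) :
    seqNorm p (fun i => c * a i) = c * seqNorm p a := by
  unfold seqNorm
  split_ifs with h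
  · rw [ENNReal.mul_iSup]
  · have := ENNReal.toReal_pos hp h
    simp only [ENNReal.mul_rpow_of_nonneg _ _ this.le]
    rw [ENNReal.tsum_mul_left, ENNReal.mul_rpow_of_nonneg _ _ (by positivity),
      ← ENNReal.rpow_mul, mul_one_div_cancel this.ne', ENNReal.rpow_one]

theorem seqNorm_comp_equiv {κ : Type*} (e : ι ≃ κ) (a : κ → ℝ≥0∞) :
    seqNorm p (fun i => a (e i)) = seqNorm p a := by
  unfold seqNorm
  split_ifs with h
  · exact e.iSup_comp (g := a)
  · congr 1; exact e.tsum_eq (fun i => a i ^ p.toReal)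

end seqNorm

/-! ### Local bounds for iterated differences -/

section differences

variable {E E' : Type*} [NormedAddCommGroup E] [NormedAddCommGroup E']

theorem fwdDiff_iter_comp_affine (f : E' → ℝ) (A : E → E') (h : E) (h' : E')
    (hA : ∀ x, A (x + h) = A x + h') (q : ℕ) (x : E) :
    (fwdDiff h)^[q] (fun y => f (A y)) x = (fwdDiff h')^[q] f (A x) := by
  induction q generalizing f with
  | zero => rfl
  | succ q ih =>
    have e : fwdDiff h (fun y => f (A y)) = fun y => fwdDiff h' f (A y) := by
      funext y
      simp [fwdDiff, hA]
    rw [Function.iterate_succ_apply, Function.iterate_succ_apply, e, ih]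

/-- Induction on the Leibniz rule `Δ(fg) = Δf · g(· + h) + f · Δg`. Its two summands produce the
factor `2 ^ q`; each shift moves the point by at most `1`, hence the radius `R + q` in the
hypotheses. -/
theorem abs_fwdDiff_iter_mul_le (h : E) (hh : ‖h‖ ≤ 1) (q : ℕ) :
    ∀ (f g : E → ℝ) (K L R : ℝ), 0 ≤ K → 0 ≤ L →
      (∀ a ≤ q, ∀ x, ‖x‖ ≤ R + q → |(fwdDiff h)^[a] f x| ≤ K * ‖h‖ ^ a) →
      (∀ a ≤ q, ∀ x, ‖x‖ ≤ R + q → |(fwdDiff h)^[a] g x| ≤ L * ‖h‖ ^ a) →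
      ∀ x, ‖x‖ ≤ R → |(fwdDiff h)^[q] (fun y => f y * g y) x| ≤ 2 ^ q * (K * L) * ‖h‖ ^ q := by
  induction q with
  | zero =>
    intro f g K L R hK hL hf hg x hx
    have h1 := hf 0 le_rfl x (by simpa using hx)
    have h2 := hg 0 le_rfl x (by simpa using hx)
    simp only [Function.iterate_zero, id_eq, pow_zero, mul_one, one_mul, abs_mul] at *
    gcongr
  | succ q ih =>
    intro f g K L R hK hL hf hg x hx
    have e : fwdDiff h (fun y => f y * g y) =
        (fun y => fwdDiff h f y * g (y + h)) + (fun y => f y * fwdDiff h g y) := by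
      funext y; simp only [fwdDiff, Pi.add_apply]; ring
    rw [Function.iterate_succ_apply, e, fwdDiff_iter_add, Pi.add_apply]
    have b1 := ih (fwdDiff h f) (fun y => g (y + h)) (K * ‖h‖) L R (by positivity) hL
      (fun a ha y hy => by
        rw [← Function.iterate_succ_apply]
        refine (hf (a + 1) (by omega) y (by push_cast; linarith)).trans (le_of_eq (by ring)))
      (fun a ha y hy => by
        rw [fwdDiff_iter_comp_affine g (fun y => y + h) h h (fun _ => rfl)]
        refine hg a (by omega) _ ((norm_add_le _ _).trans (by push_cast; linarith))) x hx
    have b2 := ih f (fwdDiff h g) K (L * ‖h‖) R hK (by positivity)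
      (fun a ha y hy => hf a (by omega) y (by push_cast; linarith))
      (fun a ha y hy => by
        rw [← Function.iterate_succ_apply]
        refine (hg (a + 1) (by omega) y (by push_cast; linarith)).trans (le_of_eq (by ring))) x hx
    refine (abs_add_le _ _).trans ((add_le_add b1 b2).trans (le_of_eq (by ring)))

/-- The iterated differences of `f` of order `q ≤ l` are `O(‖h‖ ^ q)` locally uniformly. -/
def LocDiffBound (l : ℕ) (f : E → ℝ) : Prop :=
  ∀ R : ℝ, ∃ K : ℝ, 0 ≤ K ∧ ∀ q ≤ l, ∀ h x : E, ‖h‖ ≤ 1 → ‖x‖ ≤ R →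
    |(fwdDiff h)^[q] f x| ≤ K * ‖h‖ ^ q

variable {l : ℕ}

theorem LocDiffBound.mul {f g : E → ℝ} (hf : LocDiffBound l f) (hg : LocDiffBound l g) :
    LocDiffBound l (fun x => f x * g x) := by
  intro R
  obtain ⟨K, hK, hfK⟩ := hf (R + l)
  obtain ⟨L, hL, hgL⟩ := hg (R + l)
  refine ⟨2 ^ l * (K * L), by positivity, fun q hq h x hh hx => ?_⟩
  have hql : (q : ℝ) ≤ l := by exact_mod_cast hq
  refine (abs_fwdDiff_iter_mul_le h hh q f g K L R hK hL
    (fun a ha y hy => hfK a (ha.trans hq) h y hh (by linarith))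
    (fun a ha y hy => hgL a (ha.trans hq) h y hh (by linarith)) x hx).trans ?_
  gcongr
  norm_num

theorem fwdDiff_iter_const_eq_zero (h : E) (c : ℝ) (q : ℕ) :
    (fwdDiff h)^[q + 1] (fun _ : E => c) = fun _ => 0 := by
  induction q generalizing c with
  | zero => simp
  | succ q ih => rw [Function.iterate_succ_apply, fwdDiff_const, ih]

theorem LocDiffBound.const (c : ℝ) : LocDiffBound l (fun _ : E => c) := by
  intro R
  refine ⟨|c|, abs_nonneg _, fun q _ h x _ _ => ?_⟩
  cases q with
  | zero => simp
  | succ q => rw [fwdDiff_iter_const_eq_zero]; simp only [abs_zero]; positivity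

theorem LocDiffBound.add {f g : E → ℝ} (hf : LocDiffBound l f) (hg : LocDiffBound l g) :
    LocDiffBound l (fun x => f x + g x) := by
  intro R
  obtain ⟨K, hK, hfK⟩ := hf R
  obtain ⟨L, hL, hgL⟩ := hg R
  refine ⟨K + L, by positivity, fun q hq h x hh hx => ?_⟩
  have : (fwdDiff h)^[q] (fun x => f x + g x) x = (fwdDiff h)^[q] f x + (fwdDiff h)^[q] g x :=
    congrFun (fwdDiff_iter_add h f g q) x
  rw [this, add_mul]
  exact (abs_add_le _ _).trans (add_le_add (hfK q hq h x hh hx) (hgL q hq h x hh hx))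

theorem LocDiffBound.finset_sum {ι : Type*} (s : Finset ι) {f : ι → E → ℝ}
    (hf : ∀ i ∈ s, LocDiffBound l (f i)) : LocDiffBound l (fun x => ∑ i ∈ s, f i x) := by
  classical
  induction s using Finset.induction_on with
  | empty => simpa using LocDiffBound.const 0
  | insert a s ha ih =>
    simp only [Finset.sum_insert ha]
    exact (hf a (by simp)).add (ih fun i hi => hf i (by simp [hi]))

theorem LocDiffBound.finset_prod {ι : Type*} (s : Finset ι) {f : ι → E → ℝ}
    (hf : ∀ i ∈ s, LocDiffBound l (f i)) : LocDiffBound l (fun x => ∏ i ∈ s, f i x) := by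
  classical
  induction s using Finset.induction_on with
  | empty => simpa using LocDiffBound.const 1
  | insert a s ha ih =>
    simp only [Finset.prod_insert ha]
    exact (hf a (by simp)).mul (ih fun i hi => hf i (by simp [hi]))

theorem LocDiffBound.comp_affine {f : E' → ℝ} (hf : LocDiffBound l f) (A B : E → E') (c : ℝ)
    (hA : ∀ x h, A (x + h) = A x + B h) (hB : ∀ h, ‖B h‖ ≤ ‖h‖) (hAc : ∀ x, ‖A x‖ ≤ ‖x‖ + c) :
    LocDiffBound l (fun x => f (A x)) := by
  intro R
  obtain ⟨K, hK, hfK⟩ := hf (R + c)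
  refine ⟨K, hK, fun q hq h x hh hx => ?_⟩
  rw [fwdDiff_iter_comp_affine f A h (B h) (fun x => hA x h)]
  refine (hfK q hq _ _ ((hB h).trans hh) ((hAc x).trans (by linarith))).trans ?_
  gcongr
  exact hB h

theorem locDiffBound_id : LocDiffBound l (fun t : ℝ => t) := by
  intro R
  refine ⟨max R 1, by positivity, fun q _ h x hh hx => ?_⟩
  match q with
  | 0 => simpa using Or.inl hx
  | 1 => simpa [fwdDiff] using le_mul_of_one_le_left (abs_nonneg h) (le_max_right R 1)
  | q + 2 =>
    have : fwdDiff h (fun t : ℝ => t) = fun _ => h := by funext t; simp [fwdDiff]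
    rw [Function.iterate_succ_apply, this, fwdDiff_iter_const_eq_zero]
    simp only [abs_zero]; positivity

theorem locDiffBound_pow (d : ℕ) : LocDiffBound l (fun t : ℝ => t ^ d) := by
  simpa using LocDiffBound.finset_prod (l := l) (Finset.range d) (f := fun _ (t : ℝ) => t)
    (fun _ _ => locDiffBound_id)

theorem fwdDiff_iter_congr {f g : E → ℝ} {h x : E} {q : ℕ}
    (hfg : ∀ i ≤ q, f (x + i • h) = g (x + i • h)) :
    (fwdDiff h)^[q] f x = (fwdDiff h)^[q] g x := by
  rw [fwdDiff_iter_eq_sum_shift, fwdDiff_iter_eq_sum_shift]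
  refine Finset.sum_congr rfl fun i hi => ?_
  rw [hfg i (by simpa [Nat.lt_succ_iff] using hi)]

theorem abs_fwdDiff_iter_le {f : E → ℝ} {h x : E} {q : ℕ} {M : ℝ}
    (hf : ∀ i ≤ q, |f (x + i • h)| ≤ M) : |(fwdDiff h)^[q] f x| ≤ 2 ^ q * M := by
  rw [fwdDiff_iter_eq_sum_shift]
  refine (Finset.abs_sum_le_sum_abs _ _).trans ?_
  calc _ ≤ ∑ i ∈ Finset.range (q + 1), (q.choose i : ℝ) * M := by
        refine Finset.sum_le_sum fun i hi => ?_
        rw [zsmul_eq_mul, abs_mul]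
        push_cast
        rw [abs_mul, abs_pow, abs_neg, abs_one, one_pow, one_mul, Nat.abs_cast]
        gcongr
        exact hf i (by simpa [Nat.lt_succ_iff] using hi)
    _ = _ := by
        rw [← Finset.sum_mul]
        congr 1
        exact_mod_cast Nat.sum_range_choose q

/-- If all nodes `x + i h` are nonnegative the function acts as a polynomial, and if all are
nonpositive as `0`. Otherwise some node is negative, so no node exceeds `l |h|`, and every value is
at most `(l |h|) ^ l`. -/
theorem locDiffBound_truncatedPow : LocDiffBound l (fun t : ℝ => max t 0 ^ l) := by
  rcases Nat.eq_zero_or_pos l with rfl | hl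
  · simpa using LocDiffBound.const (1 : ℝ)
  intro R
  obtain ⟨K, hK, hpow⟩ := locDiffBound_pow (l := l) l R
  refine ⟨max K (2 ^ l * (l : ℝ) ^ l), by positivity, fun q hq h x hh hx => ?_⟩
  rw [Real.norm_eq_abs] at hh hx ⊢
  by_cases h1 : ∀ i ≤ q, 0 ≤ x + i • h
  · rw [fwdDiff_iter_congr (g := fun t => t ^ l) fun i hi => by simp only [max_eq_left (h1 i hi)]]
    refine (hpow q hq h x hh hx).trans ?_
    rw [Real.norm_eq_abs]
    gcongr
    exact le_max_left _ _
  by_cases h2 : ∀ i ≤ q, x + i • h ≤ 0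
  · rw [fwdDiff_iter_congr (g := fun _ => 0) fun i hi => by
      simp only [max_eq_right (h2 i hi), zero_pow hl.ne']]
    have := abs_fwdDiff_iter_le (f := fun _ : ℝ => (0 : ℝ)) (h := h) (x := x) (q := q) (M := 0)
      (by simp)
    rw [mul_zero] at this
    exact this.trans (by positivity)
  push Not at h1 h2
  obtain ⟨a, ha, hxa⟩ := h1
  obtain ⟨b, hb, hxb⟩ := h2
  have hdiff : ∀ i ≤ q, ∀ j ≤ q, ((i : ℝ) - j) * h ≤ l * |h| := by
    intro i hi j hj
    have hi' : (i : ℝ) ≤ l := by exact_mod_cast hi.trans hq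
    have hj' : (j : ℝ) ≤ l := by exact_mod_cast hj.trans hq
    have : |(i : ℝ) - j| ≤ l := by
      rw [abs_le]; constructor <;> linarith [Nat.cast_nonneg (α := ℝ) i, Nat.cast_nonneg (α := ℝ) j]
    refine (le_abs_self _).trans ?_
    rw [abs_mul]
    gcongr
  refine (abs_fwdDiff_iter_le (M := (l * |h|) ^ l) fun i hi => ?_).trans ?_
  · rw [abs_pow]
    gcongr
    rw [abs_of_nonneg (le_max_right _ _)]
    refine max_le ?_ (by positivity)
    have := hdiff i hi a ha
    simp only [nsmul_eq_mul] at *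
    linarith
  · rw [mul_pow, ← mul_assoc]
    have e1 : (2 : ℝ) ^ q ≤ 2 ^ l := pow_le_pow_right₀ (by norm_num) hq
    have e2 : |h| ^ l ≤ |h| ^ q := pow_le_pow_of_le_one (abs_nonneg _) hh hq
    gcongr
    exact le_trans (by gcongr) (le_max_right _ _)

end differences

/-! ### Splines -/

section splines

/-- The case `d = 0` is excluded because `0 ^ 0 = 1` would undo the truncation. -/
theorem bSpline_eq_sum {d : ℕ} (hd : 1 ≤ d) (t : ℝ) :
    bSpline d t = ∑ i ∈ Finset.range (d + 2),
      ((d.factorial : ℝ)⁻¹ * ((-1) ^ i * ((d + 1).choose i : ℝ))) * max (t + -(i : ℝ)) 0 ^ d := by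
  rw [bSpline, Finset.mul_sum]
  refine Finset.sum_congr rfl fun i _ => ?_
  split_ifs with h
  · rw [max_eq_left (by linarith)]; ring
  · rw [max_eq_right (by linarith), zero_pow (by omega)]; ring

theorem continuous_bSpline {d : ℕ} (hd : 1 ≤ d) : Continuous (bSpline d) := by
  simp only [funext (bSpline_eq_sum hd)]
  fun_prop

theorem locDiffBound_bSpline {l : ℕ} (hl : 1 ≤ l) : LocDiffBound l (bSpline l) := by
  rw [funext (bSpline_eq_sum hl)]
  refine LocDiffBound.finset_sum _ fun i _ => (LocDiffBound.const _).mul ?_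
  exact (locDiffBound_truncatedPow (l := l)).comp_affine (fun t : ℝ => t + -(i : ℝ)) (fun h => h) i
    (fun x h => by ring) (fun _ => le_rfl) (fun x => (norm_add_le _ _).trans (by simp))

theorem bSpline_eq_zero_of_neg (d : ℕ) {t : ℝ} (ht : t < 0) : bSpline d t = 0 := by
  rw [bSpline, Finset.sum_eq_zero, mul_zero]
  intro i _
  rw [if_neg, mul_zero]
  have : (0 : ℝ) ≤ i := Nat.cast_nonneg i
  linarith

/-- Beyond the last knot no truncation is active, so the sum is, up to sign, a difference of order
`d + 1` of the polynomial `(t - X) ^ d` of degree at most `d`. -/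
theorem bSpline_eq_zero_of_ge (d : ℕ) {t : ℝ} (ht : (d : ℝ) + 1 ≤ t) : bSpline d t = 0 := by
  have key := Polynomial.fwdDiff_iter_eq_zero_of_degree_lt
    (P := (Polynomial.C t - Polynomial.X : Polynomial ℝ) ^ d) (n := d + 1)
    (lt_of_le_of_lt (b := d) (by
      refine Polynomial.natDegree_pow_le.trans ?_
      have : (Polynomial.C t - Polynomial.X : Polynomial ℝ).natDegree ≤ 1 := by compute_degree
      nlinarith) (by omega))
  have key0 := congrFun key 0
  rw [fwdDiff_iter_eq_sum_shift] at key0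
  have : ∑ i ∈ Finset.range (d + 2), (-1 : ℝ) ^ i * ((d + 1).choose i : ℝ) *
      (if (i : ℝ) ≤ t then (t - i) ^ d else 0) = (-1) ^ (d + 1) * 0 := by
    rw [← Pi.zero_apply (M := fun _ : ℝ => ℝ) (0 : ℝ), ← key0, Finset.mul_sum]
    refine Finset.sum_congr rfl fun i hi => ?_
    have hi' : i ≤ d + 1 := by simpa [Nat.lt_succ_iff] using hi
    have hi'' : (i : ℝ) ≤ d + 1 := by exact_mod_cast hi'
    rw [if_pos (by linarith)]
    have hs : (-1 : ℝ) ^ (d + 1) * (-1) ^ (d + 1 - i) = (-1) ^ i := by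
      obtain ⟨j, hj⟩ := Nat.exists_eq_add_of_le hi'
      rw [hj, Nat.add_sub_cancel_left, pow_add, mul_assoc, ← mul_pow]; simp
    simp only [zsmul_eq_mul, Polynomial.eval_pow, Polynomial.eval_sub, Polynomial.eval_C,
      Polynomial.eval_X, nsmul_eq_mul, mul_one, zero_add]
    push_cast
    rw [← hs]; ring
  rw [bSpline, this]; ring

/-- The cardinal tensor-product B-spline `∏ N^d(x_i)`. -/
noncomputable def cardSpline {n : ℕ} (d : ℕ) (x : Fin n → ℝ) : ℝ := ∏ i, bSpline d (x i)

variable {n : ℕ}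

theorem continuous_cardSpline {d : ℕ} (hd : 1 ≤ d) : Continuous (cardSpline (n := n) d) := by
  have := continuous_bSpline hd
  unfold cardSpline
  fun_prop

theorem locDiffBound_cardSpline {l : ℕ} (hl : 1 ≤ l) : LocDiffBound l (cardSpline (n := n) l) :=
  LocDiffBound.finset_prod _ fun i _ => (locDiffBound_bSpline hl).comp_affine
    (fun x : Fin n → ℝ => x i) (fun h => h i) 0 (fun _ _ => rfl) (fun h => norm_le_pi_norm h i)
    (fun x => by simpa using norm_le_pi_norm x i)

theorem cardSpline_eq_zero {d : ℕ} {x : Fin n → ℝ} (i : Fin n)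
    (h : x i < 0 ∨ (d : ℝ) + 1 ≤ x i) : cardSpline d x = 0 :=
  Finset.prod_eq_zero (Finset.mem_univ i)
    (h.elim (bSpline_eq_zero_of_neg d) (bSpline_eq_zero_of_ge d))

end splines

/-! ### Coefficient bounds in finite-dimensional function spaces -/

section span

variable {X ι : Type*} [TopologicalSpace X] [MeasurableSpace X] [OpensMeasurableSpace X] [Fintype ι]
  {ν : Measure X} [ν.IsOpenPosMeasure] {F : ι → X → ℝ} {U : Set X} {r : ℝ≥0∞}

/-- Coefficients of the combinations of the functions `F i` which vanish on `U`. -/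
def vanishingCoeff (F : ι → X → ℝ) (U : Set X) : Submodule ℝ (ι → ℝ) where
  carrier := {c | ∀ y ∈ U, ∑ i, c i * F i y = 0}
  add_mem' := fun {a b} ha hb y hy => by
    simp only [Pi.add_apply, add_mul, Finset.sum_add_distrib]
    rw [ha y hy, hb y hy, add_zero]
  zero_mem' := fun y _ => by simp
  smul_mem' := fun c x hx y hy => by
    simp only [Pi.smul_apply, smul_eq_mul, mul_assoc, ← Finset.mul_sum]
    rw [hx y hy, mul_zero]

theorem mem_vanishingCoeff_of_eLpNorm_eq_zero (hF : ∀ i, Continuous (F i)) (hU : IsOpen U)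
    (hr : r ≠ 0) {c : ι → ℝ} (hc : eLpNorm (fun y => ∑ i, c i * F i y) r (ν.restrict U) = 0) :
    c ∈ vanishingCoeff F U := by
  have hcont : Continuous fun y => ∑ i, c i * F i y := by fun_prop
  rw [eLpNorm_eq_zero_iff hcont.aestronglyMeasurable hr] at hc
  exact Measure.eqOn_open_of_ae_eq hc hU hcont.continuousOn continuousOn_const

/-- Compactness of the unit sphere: otherwise unit vectors of `W` with quasi-norms tending to `0`
accumulate at a unit vector `v` of `W`. Fatou's lemma, available for every `r`, shows that the
combination with coefficients `v` vanishes on `U`, so `v = 0`. -/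
theorem exists_one_le_mul_eLpNorm (hF : ∀ i, Continuous (F i)) (hU : IsOpen U)
    (hr : r ≠ 0) (W : Submodule ℝ (ι → ℝ)) (hW : Disjoint (vanishingCoeff F U) W) :
    ∃ N : ℕ, ∀ w ∈ W, ‖w‖ = 1 →
      1 ≤ ((N : ℝ≥0∞) + 1) * eLpNorm (fun y => ∑ i, w i * F i y) r (ν.restrict U) := by
  by_contra! H
  choose w hwW hw1 hwlt using H
  have hcomp : IsCompact (Metric.sphere (0 : ι → ℝ) 1) := isCompact_sphere 0 1
  obtain ⟨v, hv, φ, hφ, hlim⟩ := hcomp.tendsto_subseq (x := w) fun N => by simpa using hw1 N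
  have hvW : v ∈ W := W.closed_of_finiteDimensional.mem_of_tendsto hlim
    (Filter.Eventually.of_forall fun N => hwW _)
  have hfatou := Lp.eLpNorm_lim_le_liminf_eLpNorm (p := r) (μ := ν.restrict U)
    (f := fun N y => ∑ i, w (φ N) i * F i y)
    (fun N => ((by fun_prop : Continuous fun y => ∑ i, w (φ N) i * F i y)).aestronglyMeasurable)
    (fun y => ∑ i, v i * F i y)
    (Filter.Eventually.of_forall fun y => tendsto_finsetSum _ fun i _ =>
      (((continuous_apply i).tendsto v).comp hlim).mul_const _)
  have hzero : Filter.Tendsto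
      (fun N => eLpNorm (fun y => ∑ i, w (φ N) i * F i y) r (ν.restrict U)) Filter.atTop (nhds 0) := by
    have hb : ∀ N : ℕ, eLpNorm (fun y => ∑ i, w N i * F i y) r (ν.restrict U) ≤ (N : ℝ≥0∞)⁻¹ := by
      intro N
      rw [← one_div, ENNReal.le_div_iff_mul_le (by simp) (by simp), mul_comm]
      exact le_trans (by gcongr; simp) (hwlt N).le
    refine tendsto_of_tendsto_of_tendsto_of_le_of_le tendsto_const_nhds
      (ENNReal.tendsto_inv_nat_nhds_zero.comp hφ.tendsto_atTop) (fun _ => zero_le)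
      (fun N => hb (φ N))
  rw [hzero.liminf_eq, nonpos_iff_eq_zero] at hfatou
  have := hW.le_bot ⟨mem_vanishingCoeff_of_eLpNorm_eq_zero hF hU hr hfatou, hvW⟩
  rw [Submodule.mem_bot] at this
  simp [this] at hv

/-- The functions may be linearly dependent on `U`, as B-splines and their dilates are, so the given
coefficients need not be bounded. They are replaced by their component in a complement of
`vanishingCoeff`, which represents the same function on `U`. -/
theorem exists_coeff_bound (hF : ∀ i, Continuous (F i)) (hU : IsOpen U) (hr : r ≠ 0) :
    ∃ C : ℝ≥0, ∀ c : ι → ℝ, ∃ c' : ι → ℝ, (∀ y ∈ U, ∑ i, c i * F i y = ∑ i, c' i * F i y) ∧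
      ‖c'‖ₑ ≤ C * eLpNorm (fun y => ∑ i, c i * F i y) r (ν.restrict U) := by
  obtain ⟨W, hW⟩ := (vanishingCoeff F U).exists_isCompl
  obtain ⟨N, hN⟩ := exists_one_le_mul_eLpNorm (ν := ν) hF hU hr W hW.disjoint
  refine ⟨N + 1, fun c => ?_⟩
  obtain ⟨z, hz, w, hw, rfl⟩ := Submodule.mem_sup.1
    (show c ∈ vanishingCoeff F U ⊔ W by rw [hW.sup_eq_top]; trivial)
  have hzw : ∀ y ∈ U, ∑ i, (z + w) i * F i y = ∑ i, w i * F i y := fun y hy => by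
    simp only [Pi.add_apply, add_mul, Finset.sum_add_distrib]
    rw [hz y hy, zero_add]
  refine ⟨w, hzw, ?_⟩
  have hnorm : eLpNorm (fun y => ∑ i, (z + w) i * F i y) r (ν.restrict U) =
      eLpNorm (fun y => ∑ i, w i * F i y) r (ν.restrict U) :=
    eLpNorm_congr_ae ((ae_restrict_iff' hU.measurableSet).2 (Filter.Eventually.of_forall hzw))
  rw [hnorm]
  by_cases h0 : w = 0
  · simp [h0]
  have h0' : ‖w‖ ≠ 0 := by simpa using h0
  have h1 := hN (‖w‖⁻¹ • w) (W.smul_mem _ hw) (by rw [norm_smul, norm_inv, norm_norm,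
    inv_mul_cancel₀ h0'])
  have h2 : eLpNorm (fun y => ∑ i, w i * F i y) r (ν.restrict U) =
      ‖w‖ₑ * eLpNorm (fun y => ∑ i, (‖w‖⁻¹ • w) i * F i y) r (ν.restrict U) := by
    have := eLpNorm_const_smul ‖w‖ (fun y => ∑ i, (‖w‖⁻¹ • w) i * F i y) r (ν.restrict U)
    rw [enorm_norm] at this
    rw [← this]
    congr 1
    funext y
    simp only [Pi.smul_apply, smul_eq_mul, Finset.mul_sum]
    exact Finset.sum_congr rfl fun i _ => by field_simp
  rw [h2]
  push_cast
  calc ‖w‖ₑ = ‖w‖ₑ * 1 := (mul_one _).symm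
    _ ≤ ‖w‖ₑ * (((N : ℝ≥0∞) + 1) * eLpNorm (fun y => ∑ i, (‖w‖⁻¹ • w) i * F i y) r (ν.restrict U)) := by
        gcongr
    _ = _ := by ring

end span

/-! ### Dyadic geometry and differences of general functions -/

section geometry

variable {n : ℕ}

theorem mem_dyadicCube {k : ℕ} {m : Fin n → ℤ} {x : Fin n → ℝ} :
    x ∈ dyadicCube k m ↔ ∀ i, (m i : ℝ) < 2 ^ k * x i ∧ 2 ^ k * x i < m i + 1 := by
  have h2 : (0 : ℝ) < 2 ^ k := by positivity
  simp only [dyadicCube, openCube, corner, Set.mem_univ_pi, Set.mem_Ioo]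
  refine forall_congr' fun i => ?_
  rw [div_lt_iff₀' h2, ← one_div, ← add_div, lt_div_iff₀' h2]

theorem measurableSet_dyadicCube (k : ℕ) (m : Fin n → ℤ) : MeasurableSet (dyadicCube k m) :=
  MeasurableSet.univ_pi fun _ => measurableSet_Ioo

/-- The box concentric with the dyadic cube `(k, m)`, enlarged by `l` side lengths. -/
def nearBox (l k : ℕ) (m : Fin n → ℤ) : Set (Fin n → ℝ) :=
  {x | ∀ i, (m i : ℝ) - l < 2 ^ k * x i ∧ 2 ^ k * x i < m i + l + 1}

theorem isOpen_nearBox (l k : ℕ) (m : Fin n → ℤ) : IsOpen (nearBox l k m) := by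
  have : nearBox l k m = ⋂ i, {x : Fin n → ℝ | (m i : ℝ) - l < 2 ^ k * x i} ∩
      {x | 2 ^ k * x i < m i + l + 1} := by
    ext x; simp [nearBox]
  rw [this]
  exact isOpen_iInter_of_finite fun i => (isOpen_lt (by fun_prop) (by fun_prop)).inter
    (isOpen_lt (by fun_prop) (by fun_prop))

/-- The integer points with coordinates of absolute value at most `l`. -/
noncomputable def shiftBox (n l : ℕ) : Finset (Fin n → ℤ) :=
  Fintype.piFinset fun _ => Finset.Icc (-(l : ℤ)) l

theorem mem_shiftBox {l : ℕ} {i : Fin n → ℤ} : i ∈ shiftBox n l ↔ ∀ c, |i c| ≤ l := by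
  simp [shiftBox, abs_le]

theorem ae_exists_mem_dyadicCube (k : ℕ) :
    ∀ᵐ x : Fin n → ℝ, x ∈ dyadicCube k fun i => ⌊2 ^ k * x i⌋ := by
  have h : ∀ᵐ x : Fin n → ℝ, ∀ (i : Fin n) (z : ℤ), x i ≠ (z : ℝ) / 2 ^ k := by
    rw [ae_all_iff]; intro i
    rw [ae_all_iff]; intro z
    exact compl_mem_ae_iff.2 (Measure.pi_hyperplane (fun _ : Fin n => (volume : Measure ℝ)) i _)
  filter_upwards [h] with x hx
  rw [mem_dyadicCube]
  intro i
  refine ⟨lt_of_le_of_ne (Int.floor_le _) fun he => hx i ⌊2 ^ k * x i⌋ ?_, Int.lt_floor_add_one _⟩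
  rw [he]; field_simp

/-- Off the null set of dyadic hyperplanes, the enlarged box is tiled by the `(2l+1)^n` cubes with
indices in `m + shiftBox n l`. -/
theorem eLpNorm_nearBox_rpow_le {r : ℝ≥0∞} {μ : ℝ} (hμ : 0 < μ) (hμ1 : μ ≤ 1)
    (hμr : ENNReal.ofReal μ ≤ r) {ψ : (Fin n → ℝ) → ℝ} (hψ : AEStronglyMeasurable ψ volume)
    (l k : ℕ) (m : Fin n → ℤ) :
    eLpNorm ψ r (volume.restrict (nearBox l k m)) ^ μ ≤
      ∑ i ∈ shiftBox n l, eLpNorm ψ r (volume.restrict (dyadicCube k (m + i))) ^ μ := by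
  simp only [← eLpNorm_indicator_eq_eLpNorm_restrict (measurableSet_dyadicCube k _),
    ← eLpNorm_indicator_eq_eLpNorm_restrict (isOpen_nearBox l k m).measurableSet]
  refine eLpNorm_real_rpow_le_sum hμ hμ1 hμr _ _ _
    (fun i _ => hψ.indicator (measurableSet_dyadicCube k _)) ?_
  filter_upwards [ae_exists_mem_dyadicCube k] with x hx
  by_cases hxn : x ∈ nearBox l k m
  · set M : Fin n → ℤ := fun i => ⌊2 ^ k * x i⌋ with hM
    have hmem : M - m ∈ shiftBox n l := by
      rw [mem_shiftBox]
      intro c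
      have h1 := (mem_dyadicCube.1 hx c)
      have h2 := hxn c
      have h3 : (m c : ℝ) - l < M c + 1 := by linarith
      have h4 : (M c : ℝ) < m c + l + 1 := by linarith
      have h3' : m c - l < M c + 1 := by exact_mod_cast h3
      have h4' : M c < m c + l + 1 := by exact_mod_cast h4
      rw [Pi.sub_apply, abs_le]; constructor <;> omega
    rw [Set.indicator_of_mem hxn]
    refine le_trans (le_of_eq ?_) (Finset.single_le_sum
      (f := fun i => ‖(dyadicCube k (m + i)).indicator ψ x‖ₑ) (fun _ _ => zero_le) hmem)
    simp only [add_sub_cancel]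
    rw [Set.indicator_of_mem hx]
  · rw [Set.indicator_of_notMem hxn]; simp

end geometry

/-! ### Dyadic scaling and bounds for `delta` -/

section scaling

variable {n : ℕ}

theorem ofReal_two_pow_inv (k : ℕ) : ENNReal.ofReal ((2 ^ k : ℝ)⁻¹) = (2 : ℝ≥0∞) ^ (-(k : ℝ)) := by
  rw [ENNReal.ofReal_inv_of_pos (by positivity), ENNReal.ofReal_pow (by norm_num),
    ENNReal.rpow_neg, ENNReal.rpow_natCast]
  norm_num

theorem two_rpow_add (x y : ℝ) : (2 : ℝ≥0∞) ^ (x + y) = 2 ^ x * 2 ^ y :=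
  ENNReal.rpow_add _ _ (by norm_num) (by norm_num)

theorem volume_symmCube (k : ℕ) :
    volume (Set.univ.pi fun _ : Fin n => Set.Ioo (-(2 ^ k : ℝ)⁻¹) (2 ^ k : ℝ)⁻¹) =
      (2 : ℝ≥0∞) ^ ((1 - (k : ℝ)) * n) := by
  rw [Real.volume_pi_Ioo, Finset.prod_const, Finset.card_univ, Fintype.card_fin, sub_neg_eq_add,
    ← two_mul, ENNReal.ofReal_mul (by norm_num), ofReal_two_pow_inv, ENNReal.rpow_mul,
    ENNReal.rpow_natCast, sub_eq_add_neg, two_rpow_add]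
  norm_num

theorem volume_openCube (k : ℕ) (a : Fin n → ℝ) :
    volume (openCube a ((2 ^ k : ℝ)⁻¹)) = (2 : ℝ≥0∞) ^ (-(k : ℝ) * n) := by
  rw [openCube, Real.volume_pi_Ioo]
  simp only [add_sub_cancel_left]
  rw [Finset.prod_const, Finset.card_univ, Fintype.card_fin, ofReal_two_pow_inv, ENNReal.rpow_mul,
    ENNReal.rpow_natCast]

/-- The measure on pairs (step, point) underlying `delta`. -/
noncomputable def deltaMeasure (k : ℕ) (m : Fin n → ℤ) :
    Measure ((Fin n → ℝ) × (Fin n → ℝ)) :=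
  (volume.restrict (Set.univ.pi fun _ : Fin n => Set.Ioo (-(2 ^ k : ℝ)⁻¹) (2 ^ k : ℝ)⁻¹)).prod
    (volume.restrict (dyadicCube k m))

theorem delta_eq (l k : ℕ) (r : ℝ≥0∞) (m : Fin n → ℤ) (f : (Fin n → ℝ) → ℝ) :
    delta l r (corner k m) ((2 ^ k : ℝ)⁻¹) f = (2 : ℝ≥0∞) ^ (2 * (k : ℝ) * n / r.toReal) *
      eLpNorm (fun q : (Fin n → ℝ) × (Fin n → ℝ) => (fwdDiff q.1)^[l] f q.2) r
        (deltaMeasure k m) := by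
  rw [delta, ofReal_two_pow_inv, ← ENNReal.rpow_mul]
  congr 2
  ring

theorem ae_deltaMeasure (k : ℕ) (m : Fin n → ℤ) :
    ∀ᵐ q ∂deltaMeasure k m, ‖(2 : ℝ) ^ k • q.1‖ ≤ 1 ∧ q.2 ∈ dyadicCube k m := by
  rw [deltaMeasure, Measure.prod_restrict, ae_restrict_iff' ((MeasurableSet.univ_pi
    fun _ => measurableSet_Ioo).prod (measurableSet_dyadicCube k m))]
  refine Filter.Eventually.of_forall fun q hq => ⟨?_, hq.2⟩
  have h2 : (0 : ℝ) < 2 ^ k := by positivity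
  rw [norm_smul, Real.norm_of_nonneg h2.le, ← le_div_iff₀' h2, one_div,
    pi_norm_le_iff_of_nonneg (by positivity)]
  intro i
  have := hq.1 i (Set.mem_univ i)
  exact (abs_lt.2 this).le

/-- The total mass of `deltaMeasure k m` is `2^{n - 2kn}`, so the normalization `2^{2kn/r}` leaves
exactly `2^{n/r}`. -/
theorem delta_le_of_bound {l k : ℕ} {r : ℝ≥0∞} {m : Fin n → ℤ} {f : (Fin n → ℝ) → ℝ} {B : ℝ≥0∞}
    (hB : ∀ h x : Fin n → ℝ, ‖(2 : ℝ) ^ k • h‖ ≤ 1 → x ∈ dyadicCube k m →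
      ‖(fwdDiff h)^[l] f x‖ₑ ≤ B) :
    delta l r (corner k m) ((2 ^ k : ℝ)⁻¹) f ≤ (2 : ℝ≥0∞) ^ ((n : ℝ) / r.toReal) * B := by
  rw [delta_eq]
  have := eLpNorm_le_of_ae_enorm_bound (p := r)
    (f := fun q : (Fin n → ℝ) × (Fin n → ℝ) => (fwdDiff q.1)^[l] f q.2)
    ((ae_deltaMeasure k m).mono fun q hq => hB q.1 q.2 hq.1 hq.2)
  refine (mul_le_mul_right this _).trans (le_of_eq ?_)
  rw [deltaMeasure, Measure.prod_restrict, Measure.restrict_apply_univ, Measure.prod_prod,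
    volume_symmCube, dyadicCube, volume_openCube, ← two_rpow_add, ← ENNReal.rpow_mul, smul_eq_mul,
    mul_left_comm, ← two_rpow_add, mul_comm]
  congr 2
  ring

/-- For each fixed step `h`, translation by `j h` preserves volume and moves the cube by at most `l`
side lengths, hence into `nearBox`. Integrating over `h` contributes the volume of the cube of
steps. -/
theorem map_shift_deltaMeasure_le {l k : ℕ} (m : Fin n → ℤ) {j : ℕ} (hj : j ≤ l) :
    Measure.map (fun q : (Fin n → ℝ) × (Fin n → ℝ) => q.2 + j • q.1) (deltaMeasure k m) ≤
      (2 : ℝ≥0∞) ^ ((1 - (k : ℝ)) * n) • volume.restrict (nearBox l k m) := by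
  have hT : Measurable (fun q : (Fin n → ℝ) × (Fin n → ℝ) => q.2 + j • q.1) := by fun_prop
  refine Measure.le_iff.2 fun A hA => ?_
  rw [Measure.map_apply hT hA, deltaMeasure, Measure.prod_apply (hT hA)]
  have hH : MeasurableSet (Set.univ.pi fun _ : Fin n => Set.Ioo (-(2 ^ k : ℝ)⁻¹) (2 ^ k : ℝ)⁻¹) :=
    MeasurableSet.univ_pi fun _ => measurableSet_Ioo
  have hle : ∀ h ∈ (Set.univ.pi fun _ : Fin n => Set.Ioo (-(2 ^ k : ℝ)⁻¹) (2 ^ k : ℝ)⁻¹),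
      (volume.restrict (dyadicCube k m))
        (Prod.mk h ⁻¹' ((fun q : (Fin n → ℝ) × (Fin n → ℝ) => q.2 + j • q.1) ⁻¹' A)) ≤
      volume.restrict (nearBox l k m) A := by
    intro h hh
    rw [Measure.restrict_apply hA, Measure.restrict_apply (measurable_prodMk_left (hT hA)),
      ← measure_preimage_add_right volume (j • h) (A ∩ nearBox l k m)]
    refine measure_mono fun x hx => ⟨hx.1, fun i => ?_⟩
    have h1 := mem_dyadicCube.1 hx.2 i
    have h2 := hh i (Set.mem_univ i)
    have h3 : |2 ^ k * h i| ≤ 1 := by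
      have h2k : (0 : ℝ) < 2 ^ k := by positivity
      rw [abs_mul, abs_of_pos h2k, ← le_div_iff₀' h2k, one_div]
      exact (abs_lt.2 h2).le
    have h4 : |(j : ℝ) * (2 ^ k * h i)| ≤ l := by
      rw [abs_mul, Nat.abs_cast]
      have : (j : ℝ) ≤ l := by exact_mod_cast hj
      nlinarith [abs_nonneg (2 ^ k * h i), Nat.cast_nonneg (α := ℝ) j]
    have h5 := abs_le.1 h4
    have h6 : (x + j • h) i = x i + j * h i := by simp
    change _ < 2 ^ k * (x + j • h) i ∧ 2 ^ k * (x + j • h) i < _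
    rw [h6]
    constructor <;> nlinarith
  calc _ ≤ ∫⁻ _ in (Set.univ.pi fun _ : Fin n => Set.Ioo (-(2 ^ k : ℝ)⁻¹) (2 ^ k : ℝ)⁻¹),
        volume.restrict (nearBox l k m) A := setLIntegral_mono' hH hle
    _ = _ := by
      rw [setLIntegral_const, volume_symmCube, mul_comm]; rfl

/-- The measure bound also yields measurability: it makes the image measure absolutely continuous,
so a function that is only a.e. measurable can be composed with the shift. -/
theorem eLpNorm_shift_le {l k : ℕ} {r : ℝ≥0∞} (m : Fin n → ℤ) {j : ℕ} (hj : j ≤ l)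
    {ψ : (Fin n → ℝ) → ℝ} (hψ : AEStronglyMeasurable ψ volume) :
    AEStronglyMeasurable (fun q : (Fin n → ℝ) × (Fin n → ℝ) => ψ (q.2 + j • q.1))
        (deltaMeasure k m) ∧
      eLpNorm (fun q : (Fin n → ℝ) × (Fin n → ℝ) => ψ (q.2 + j • q.1)) r (deltaMeasure k m) ≤
        (2 : ℝ≥0∞) ^ ((1 - (k : ℝ)) * n / r.toReal) *
          eLpNorm ψ r (volume.restrict (nearBox l k m)) := by
  have hT : Measurable (fun q : (Fin n → ℝ) × (Fin n → ℝ) => q.2 + j • q.1) := by fun_prop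
  have hmap := map_shift_deltaMeasure_le (k := k) m hj
  have hac : AEStronglyMeasurable ψ
      (Measure.map (fun q : (Fin n → ℝ) × (Fin n → ℝ) => q.2 + j • q.1) (deltaMeasure k m)) :=
    ((hψ.restrict (s := nearBox l k m)).smul_measure _).mono_measure hmap
  refine ⟨hac.comp_measurable hT, ?_⟩
  have := eLpNorm_map_measure (p := r) hac hT.aemeasurable
  calc _ = _ := this.symm
    _ ≤ _ := eLpNorm_mono_measure _ hmap
    _ ≤ _ := eLpNorm_smul_measure_le _ _ _ _
    _ = _ := by
      rw [smul_eq_mul, ← ENNReal.rpow_mul]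
      congr 2
      simp [div_eq_mul_inv]

/-- Differences of an arbitrary function are controlled by its size on the enlarged cube. -/
theorem delta_rpow_le {r : ℝ≥0∞} {μ : ℝ} (hμ : 0 < μ) (hμ1 : μ ≤ 1)
    (hμr : ENNReal.ofReal μ ≤ r) {ψ : (Fin n → ℝ) → ℝ} (hψ : AEStronglyMeasurable ψ volume)
    (l k : ℕ) (m : Fin n → ℤ) :
    delta l r (corner k m) ((2 ^ k : ℝ)⁻¹) ψ ^ μ ≤
      (l + 1 : ℕ) * ((2 : ℝ≥0∞) ^ l * 2 ^ ((n : ℝ) / r.toReal)) ^ μ *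
        (scale n k r * eLpNorm ψ r (volume.restrict (nearBox l k m))) ^ μ := by
  set N := eLpNorm ψ r (volume.restrict (nearBox l k m)) with hN
  have h1 := eLpNorm_real_rpow_le_sum (ν := deltaMeasure k m) hμ hμ1 hμr (Finset.range (l + 1))
    (fun q : (Fin n → ℝ) × (Fin n → ℝ) => (fwdDiff q.1)^[l] ψ q.2)
    (fun j q => (l.choose j : ℝ) • ψ (q.2 + j • q.1))
    (fun j hj => (eLpNorm_shift_le (r := r) m
      (by simpa [Nat.lt_succ_iff] using hj : j ≤ l) hψ).1.const_smul (l.choose j : ℝ))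
    (Filter.Eventually.of_forall fun q => by
      rw [fwdDiff_iter_eq_sum_shift]
      refine (enorm_sum_le _ _).trans (le_of_eq (Finset.sum_congr rfl fun j _ => ?_))
      rw [zsmul_eq_mul, smul_eq_mul, enorm_mul, enorm_mul]
      push_cast
      rw [enorm_mul, enorm_pow, enorm_neg]
      simp)
  have h2 : ∀ j ∈ Finset.range (l + 1),
      eLpNorm (fun q : (Fin n → ℝ) × (Fin n → ℝ) => (l.choose j : ℝ) • ψ (q.2 + j • q.1)) r
        (deltaMeasure k m) ^ μ ≤
      ((2 : ℝ≥0∞) ^ l * ((2 : ℝ≥0∞) ^ ((1 - (k : ℝ)) * n / r.toReal) * N)) ^ μ := by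
    intro j hj
    refine ENNReal.rpow_le_rpow ?_ hμ.le
    have hc := eLpNorm_const_smul (l.choose j : ℝ)
      (fun q : (Fin n → ℝ) × (Fin n → ℝ) => ψ (q.2 + j • q.1)) r (deltaMeasure k m)
    refine (le_of_eq hc).trans (mul_le_mul' ?_ (eLpNorm_shift_le (r := r) m
      (by simpa [Nat.lt_succ_iff] using hj : j ≤ l) hψ).2)
    rw [Real.enorm_natCast]
    exact_mod_cast Nat.choose_le_two_pow l j
  rw [delta_eq, ENNReal.mul_rpow_of_nonneg _ _ hμ.le]
  refine (mul_le_mul_right (h1.trans (Finset.sum_le_sum h2)) _).trans (le_of_eq ?_)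
  rw [Finset.sum_const, Finset.card_range, nsmul_eq_mul, mul_left_comm,
    mul_assoc (((l + 1 : ℕ)) : ℝ≥0∞)]
  congr 1
  rw [← ENNReal.mul_rpow_of_nonneg _ _ hμ.le, ← ENNReal.mul_rpow_of_nonneg _ _ hμ.le]
  congr 1
  have e : (2 : ℝ≥0∞) ^ (2 * (k : ℝ) * n / r.toReal) * 2 ^ ((1 - (k : ℝ)) * n / r.toReal) =
      2 ^ ((n : ℝ) / r.toReal) * scale n k r := by
    rw [scale, ← two_rpow_add, ← two_rpow_add]
    congr 1
    ring
  calc _ = (2 : ℝ≥0∞) ^ l * ((2 : ℝ≥0∞) ^ (2 * (k : ℝ) * n / r.toReal) *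
        2 ^ ((1 - (k : ℝ)) * n / r.toReal)) * N := by ring
    _ = _ := by rw [e]; ring

end scaling

/-! ### Local expansions of splines and their differences -/

section expansion

variable {n : ℕ}

/-- Indices of the cardinal splines, and of their dilates by `2`, not vanishing identically near the
unit cube. -/
noncomputable def splineIndex (n l : ℕ) : Finset (Fin n → ℤ) :=
  Fintype.piFinset fun _ => Finset.Icc (-(3 * l + 2 : ℤ)) (l + 1)

/-- The translates of the cardinal spline and of its dilate by `2`. -/
noncomputable def splineFamily (l : ℕ) (i : Bool × (Fin n → ℤ)) (y : Fin n → ℝ) : ℝ :=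
  cardSpline l fun c => (bif i.1 then 1 else 2⁻¹) * (y c + -(i.2 c : ℝ))

theorem continuous_splineFamily {l : ℕ} (hl : 1 ≤ l) (i : Bool × (Fin n → ℤ)) :
    Continuous (splineFamily l i) :=
  (continuous_cardSpline hl).comp (by fun_prop)

theorem locDiffBound_splineFamily {l : ℕ} (hl : 1 ≤ l) (i : Bool × (Fin n → ℤ)) :
    LocDiffBound l (splineFamily l i) := by
  have hb : ∀ b : Bool, ‖(bif b then 1 else 2⁻¹ : ℝ)‖ ≤ 1 := by
    rintro (_ | _) <;> norm_num
  refine (locDiffBound_cardSpline hl).comp_affine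
    (fun y : Fin n → ℝ => fun c => (bif i.1 then 1 else 2⁻¹) * (y c + -(i.2 c : ℝ)))
    (fun h => (bif i.1 then 1 else 2⁻¹ : ℝ) • h) ‖fun c => (i.2 c : ℝ)‖ ?_ ?_ ?_
  · intro x h
    funext c
    simp only [Pi.add_apply, Pi.smul_apply, smul_eq_mul]
    ring
  · intro h
    rw [norm_smul]
    exact mul_le_of_le_one_left (norm_nonneg _) (hb _)
  · intro x
    have : (fun c => (bif i.1 then 1 else 2⁻¹ : ℝ) * (x c + -(i.2 c : ℝ))) =
        (bif i.1 then 1 else 2⁻¹ : ℝ) • (x - fun c => (i.2 c : ℝ)) := by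
      funext c; simp [sub_eq_add_neg]
    rw [this, norm_smul]
    exact (mul_le_of_le_one_left (norm_nonneg _) (hb _)).trans (norm_sub_le _ _)

/-- Here `-l < y c < l + 1`. The upper end of `splineIndex` is where the argument turns negative;
the lower end comes from the dilates, whose support has side `2(l + 1)`. -/
theorem splineFamily_eq_zero {l : ℕ} (b : Bool) {i : Fin n → ℤ} (hi : i ∉ splineIndex n l)
    {y : Fin n → ℝ} (hy : y ∈ nearBox l 0 0) : splineFamily l (b, i) y = 0 := by
  simp only [splineIndex, Fintype.mem_piFinset, not_forall, Finset.mem_Icc] at hi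
  obtain ⟨c, hc⟩ := hi
  have hyc := hy c
  simp only [Pi.zero_apply, Int.cast_zero, pow_zero, one_mul, zero_sub, zero_add] at hyc
  have hl0 : (0 : ℝ) ≤ l := Nat.cast_nonneg l
  refine cardSpline_eq_zero c ?_
  by_cases h1 : (l : ℤ) + 1 < i c
  · left
    have : (l : ℝ) + 1 < i c := by exact_mod_cast h1
    cases b <;> simp <;> linarith
  · right
    have h2 : i c ≤ -(3 * l + 3 : ℤ) := by
      by_contra h3; exact hc ⟨by omega, by omega⟩
    have : (i c : ℝ) ≤ -(3 * l + 3) := by exact_mod_cast h2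
    cases b <;> simp <;> linarith

/-- The affine map taking the unit cube to the dyadic cube `(j, M)`. -/
noncomputable def cubeMap (j : ℕ) (M : Fin n → ℤ) (y : Fin n → ℝ) : Fin n → ℝ :=
  fun c => (2 ^ j : ℝ)⁻¹ * (y c + M c)

/-- Near each dyadic cube of level `j`, the rescaled function `g` is a combination of the
functions `splineFamily l i`. -/
def HasLocalExpansion (l j : ℕ) (g : (Fin n → ℝ) → ℝ) : Prop :=
  ∀ M : Fin n → ℤ, ∃ c : Bool × splineIndex n l → ℝ, ∀ y ∈ nearBox l 0 (0 : Fin n → ℤ),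
    g (cubeMap j M y) = ∑ i, c i * splineFamily l (i.1, i.2) y

theorem HasLocalExpansion.sub {l j : ℕ} {f g : (Fin n → ℝ) → ℝ} (hf : HasLocalExpansion l j f)
    (hg : HasLocalExpansion l j g) : HasLocalExpansion l j (fun x => f x - g x) := by
  intro M
  obtain ⟨a, ha⟩ := hf M
  obtain ⟨b, hb⟩ := hg M
  refine ⟨a - b, fun y hy => ?_⟩
  simp only [Pi.sub_apply, sub_mul, Finset.sum_sub_distrib, ha y hy, hb y hy]

theorem exists_expansion {l : ℕ} (b : Bool) (e : (Fin n → ℤ) → (Fin n → ℤ))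
    (he : Function.Injective e) (β : (Fin n → ℤ) → ℝ) :
    ∃ c : Bool × splineIndex n l → ℝ, ∀ y ∈ nearBox l 0 (0 : Fin n → ℤ),
      ∑' m, β m * splineFamily l (b, e m) y = ∑ i, c i * splineFamily l (i.1, i.2) y := by
  -- The coefficients are transported along `e`, extended by zero off its range, and set to zero on
  -- the other half of the family.
  refine ⟨fun i => if i.1 = b then Function.extend e β 0 i.2 else 0, fun y hy => ?_⟩
  have h1 : ∀ m, β m * splineFamily l (b, e m) y =
      (fun i => Function.extend e β 0 i * splineFamily l (b, i) y) (e m) := by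
    intro m; simp only [he.extend_apply]
  rw [tsum_congr h1, he.tsum_eq (f := fun i => Function.extend e β 0 i * splineFamily l (b, i) y),
    tsum_eq_sum (s := splineIndex n l)]
  · rw [← Finset.sum_coe_sort, Fintype.sum_prod_type, Finset.sum_eq_single b]
    · simp
    · intro b' _ hb'; simp [hb']
    · simp
  · intro i hi
    rw [splineFamily_eq_zero b hi hy, mul_zero]
  · intro i hi
    by_contra h
    exact hi (by simp [Function.extend_apply' _ _ _ h])

theorem hasLocalExpansion_of_mem {l j : ℕ} {S : (Fin n → ℝ) → ℝ} (hS : S ∈ splineSpace n l j) :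
    HasLocalExpansion l j S := by
  obtain ⟨β, hβ⟩ := hS
  intro M
  obtain ⟨c, hc⟩ := exists_expansion (l := l) true (fun m => m - M) (sub_left_injective) β
  refine ⟨c, fun y hy => ?_⟩
  rw [← hc y hy, hβ]
  refine tsum_congr fun m => ?_
  simp only [tensorSpline, splineFamily, cardSpline, cubeMap]
  congr 2
  funext i
  congr 1
  simp
  field_simp
  ring

/-- With `x = 2^{-(j+1)} (y + M)` one has `2^j x - m = (y - (2m - M)) / 2`. Keeping the dilates in
the family thus makes the two-scale relation of B-splines unnecessary. -/
theorem hasLocalExpansion_succ_of_mem {l j : ℕ} {S : (Fin n → ℝ) → ℝ}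
    (hS : S ∈ splineSpace n l j) : HasLocalExpansion l (j + 1) S := by
  obtain ⟨β, hβ⟩ := hS
  intro M
  obtain ⟨c, hc⟩ := exists_expansion (l := l) false (fun m => 2 • m - M) (fun a b hab => by
    funext i
    have := congrFun hab i
    simp at this
    exact this) β
  refine ⟨c, fun y hy => ?_⟩
  rw [← hc y hy, hβ]
  refine tsum_congr fun m => ?_
  simp only [tensorSpline, splineFamily, cardSpline, cubeMap]
  congr 2
  funext i
  congr 1
  simp
  field_simp
  ring

theorem cubeMap_mem_nearBox {l j : ℕ} {M : Fin n → ℤ} {y : Fin n → ℝ} :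
    cubeMap j M y ∈ nearBox l j M ↔ y ∈ nearBox l 0 (0 : Fin n → ℤ) := by
  refine forall_congr' fun i => ?_
  have : (2 : ℝ) ^ j * cubeMap j M y i = y i + M i := by
    simp only [cubeMap]; field_simp
  rw [this]
  simp only [Pi.zero_apply, Int.cast_zero, pow_zero, one_mul, zero_sub, zero_add]
  constructor <;> rintro ⟨h1, h2⟩ <;> constructor <;> linarith

theorem cubeMap_sub (j : ℕ) (M : Fin n → ℤ) (x : Fin n → ℝ) :
    cubeMap j M (fun c => 2 ^ j * x c - M c) = x := by
  funext c; simp [cubeMap]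

theorem HasLocalExpansion.continuous {l j : ℕ} (hl : 1 ≤ l) {g : (Fin n → ℝ) → ℝ}
    (hg : HasLocalExpansion l j g) : Continuous g := by
  rw [continuous_iff_continuousAt]
  intro x
  set M : Fin n → ℤ := fun c => ⌊2 ^ j * x c⌋
  obtain ⟨c, hc⟩ := hg M
  have hx : x ∈ nearBox l j M := by
    intro i
    have h1 := Int.floor_le (2 ^ j * x i)
    have h2 := Int.lt_floor_add_one (2 ^ j * x i)
    have h3 : (1 : ℝ) ≤ l := by exact_mod_cast hl
    constructor <;> simp only [M] <;> linarith
  have hcont : Continuous fun z : Fin n → ℝ =>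
      ∑ i, c i * splineFamily l (i.1, i.2) (fun a => 2 ^ j * z a - M a) :=
    continuous_finsetSum _ fun i _ => continuous_const.mul
      ((continuous_splineFamily hl _).comp (by fun_prop))
  refine hcont.continuousAt.congr ?_
  filter_upwards [(isOpen_nearBox l j M).mem_nhds hx] with z hz
  rw [← hc, cubeMap_sub]
  rwa [← cubeMap_mem_nearBox (j := j) (M := M), cubeMap_sub]

theorem map_cubeMap (j : ℕ) (M : Fin n → ℤ) :
    Measure.map (cubeMap j M) volume = (2 : ℝ≥0∞) ^ ((j : ℝ) * n) • (volume : Measure (Fin n → ℝ)) := by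
  have h2 : ((2 : ℝ) ^ j)⁻¹ ≠ 0 := by positivity
  have hcomp : (cubeMap j M : (Fin n → ℝ) → _) =
      (fun y => ((2 : ℝ) ^ j)⁻¹ • y) ∘ (fun y => y + fun c => (M c : ℝ)) := by
    funext y c; simp [cubeMap]
  rw [hcomp, ← Measure.map_map (by fun_prop) (by fun_prop), map_add_right_eq_self,
    Measure.map_addHaar_smul volume h2]
  congr 1
  rw [Module.finrank_fin_fun, inv_pow, inv_inv, abs_of_pos (by positivity),
    ENNReal.ofReal_pow (by positivity), ENNReal.ofReal_pow (by norm_num), ENNReal.rpow_mul,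
    ENNReal.rpow_natCast, ENNReal.rpow_natCast]
  norm_num

theorem eLpNorm_comp_cubeMap {g : (Fin n → ℝ) → ℝ} (hg : Continuous g) (l j : ℕ) (r : ℝ≥0∞)
    (M : Fin n → ℤ) :
    eLpNorm (fun y => g (cubeMap j M y)) r (volume.restrict (nearBox l 0 0)) =
      scale n j r * eLpNorm g r (volume.restrict (nearBox l j M)) := by
  have hA : Measurable (cubeMap j M) := by
    refine Continuous.measurable ?_
    unfold cubeMap; fun_prop
  have hpre : (nearBox l 0 (0 : Fin n → ℤ)) = cubeMap j M ⁻¹' nearBox l j M := by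
    ext y; exact cubeMap_mem_nearBox.symm
  have h := eLpNorm_map_measure (p := r) (f := cubeMap j M)
    (μ := volume.restrict (nearBox l 0 (0 : Fin n → ℤ))) hg.aestronglyMeasurable hA.aemeasurable
  refine h.symm.trans ?_
  rw [hpre, ← Measure.restrict_map hA (isOpen_nearBox l j M).measurableSet, map_cubeMap,
    Measure.restrict_smul, eLpNorm_smul_measure_of_ne_zero (by simp), smul_eq_mul, scale,
    ← ENNReal.rpow_mul]
  congr 2
  simp [div_eq_mul_inv]

/-- Spline increments of level `j` have `l`-th differences of order `2 ^ ((j - k) l)` on cubes of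
level `k`. -/
theorem exists_delta_le_of_hasLocalExpansion (n : ℕ) {l : ℕ} (hl : 1 ≤ l) {r : ℝ≥0∞} (hr : r ≠ 0) :
    ∃ C : ℝ≥0, ∀ (j k : ℕ), j ≤ k → ∀ m M : Fin n → ℤ, dyadicCube k m ⊆ dyadicCube j M →
      ∀ g : (Fin n → ℝ) → ℝ, HasLocalExpansion l j g →
      delta l r (corner k m) ((2 ^ k : ℝ)⁻¹) g ≤ C * (2 : ℝ≥0∞) ^ ((l : ℝ) * ((j : ℝ) - k)) *
        (scale n j r * eLpNorm g r (volume.restrict (nearBox l j M))) := by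
  obtain ⟨C, hC⟩ := exists_coeff_bound (ν := (volume : Measure (Fin n → ℝ)))
    (F := fun i : Bool × splineIndex n l => splineFamily l (i.1, (i.2 : Fin n → ℤ)))
    (U := nearBox l 0 0) (fun i => continuous_splineFamily hl _) (isOpen_nearBox l 0 0) hr
  -- Radius `1` suffices, because the base point `y` below lies in the unit cube.
  choose K hK0 hK using fun i : Bool × splineIndex n l =>
    locDiffBound_splineFamily hl (i.1, (i.2 : Fin n → ℤ)) 1
  set Kt : ℝ≥0 := ∑ i, (K i).toNNReal with hKt
  have hC2 : (2 : ℝ≥0∞) ^ ((n : ℝ) / r.toReal) ≠ ∞ :=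
    ENNReal.rpow_ne_top_of_nonneg (by positivity) (by norm_num)
  lift (2 : ℝ≥0∞) ^ ((n : ℝ) / r.toReal) to ℝ≥0 using hC2 with D hD
  refine ⟨D * (Kt * C), fun j k hjk m M hsub g hg => ?_⟩
  obtain ⟨c, hc⟩ := hg M
  obtain ⟨c', hcc', hc'⟩ := hC c
  have hcont := hg.continuous hl
  have hnorm : eLpNorm (fun y => ∑ i, c i * splineFamily l (i.1, (i.2 : Fin n → ℤ)) y) r
      (volume.restrict (nearBox l 0 0)) =
      scale n j r * eLpNorm g r (volume.restrict (nearBox l j M)) := by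
    rw [← eLpNorm_comp_cubeMap hcont]
    exact eLpNorm_congr_ae ((ae_restrict_iff' (isOpen_nearBox l 0 0).measurableSet).2
      (Filter.Eventually.of_forall fun y hy => (hc y hy).symm))
  rw [hnorm] at hc'
  set e := scale n j r * eLpNorm g r (volume.restrict (nearBox l j M)) with he
  have hpt : ∀ h x : Fin n → ℝ, ‖(2 : ℝ) ^ k • h‖ ≤ 1 → x ∈ dyadicCube k m →
      ‖(fwdDiff h)^[l] g x‖ₑ ≤ Kt * (C * e) * (2 : ℝ≥0∞) ^ ((l : ℝ) * ((j : ℝ) - k)) := by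
    intro h x hh hx
    have hxM := mem_dyadicCube.1 (hsub hx)
    set y : Fin n → ℝ := fun c => 2 ^ j * x c - M c with hy
    set H : Fin n → ℝ := (2 : ℝ) ^ j • h with hH
    have hHk : ‖H‖ ≤ (2 : ℝ) ^ ((j : ℝ) - k) := by
      rw [norm_smul, Real.norm_of_nonneg (by positivity)] at hh
      rw [hH, norm_smul, Real.norm_of_nonneg (by positivity), Real.rpow_sub (by norm_num),
        Real.rpow_natCast, Real.rpow_natCast, div_eq_mul_inv]
      gcongr
      rwa [← one_div, le_div_iff₀' (by positivity)]
    have hH1 : ‖H‖ ≤ 1 := hHk.trans (Real.rpow_le_one_of_one_le_of_nonpos (by norm_num)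
      (by have : (j : ℝ) ≤ k := by exact_mod_cast hjk
          linarith))
    have hy01 : ∀ i, 0 < y i ∧ y i < 1 := fun i => by
      have := hxM i
      constructor <;> simp only [hy] <;> linarith
    have hy1 : ‖y‖ ≤ 1 := by
      rw [pi_norm_le_iff_of_nonneg zero_le_one]
      intro i
      rw [Real.norm_eq_abs, abs_le]
      constructor <;> linarith [hy01 i]
    -- All nodes of the rescaled difference stay in the box on which the expansions with `c` and
    -- with the bounded `c'` agree, so `c'` may be used in the difference.
    have hU : ∀ a ≤ l, y + a • H ∈ nearBox l 0 (0 : Fin n → ℤ) := by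
      intro a ha i
      have h1 : |H i| ≤ 1 := (norm_le_pi_norm H i).trans hH1
      have h2 : |(a : ℝ) * H i| ≤ l := by
        have : (a : ℝ) ≤ l := by exact_mod_cast ha
        rw [abs_mul, Nat.abs_cast]
        nlinarith [abs_nonneg (H i), Nat.cast_nonneg (α := ℝ) a]
      have h3 := abs_le.1 h2
      have h4 : (y + a • H) i = y i + a * H i := by simp
      rw [h4]
      simp only [Pi.zero_apply, Int.cast_zero, pow_zero, one_mul, zero_sub, zero_add]
      constructor <;> linarith [hy01 i]
    have hstep : (fwdDiff h)^[l] g x =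
        ∑ i, c' i * (fwdDiff H)^[l] (splineFamily l (i.1, (i.2 : Fin n → ℤ))) y := by
      have h1 := fwdDiff_iter_comp_affine g (cubeMap j M) H h (fun z => by
        funext i; simp [cubeMap, hH]; field_simp; ring) l y
      rw [hy, cubeMap_sub, ← hy] at h1
      rw [← h1, fwdDiff_iter_congr (g := ∑ i, c' i • splineFamily l (i.1, (i.2 : Fin n → ℤ)))
        (fun a ha => by rw [hc _ (hU a ha), hcc' _ (hU a ha)]; simp)]
      rw [fwdDiff_iter_finsetSum, Finset.sum_apply]
      refine Finset.sum_congr rfl fun i _ => ?_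
      rw [fwdDiff_iter_const_smul]; rfl
    have hpow : ENNReal.ofReal (‖H‖ ^ l) ≤ (2 : ℝ≥0∞) ^ ((l : ℝ) * ((j : ℝ) - k)) := by
      rw [mul_comm, ENNReal.rpow_mul, ENNReal.rpow_natCast, ENNReal.ofReal_pow (norm_nonneg _)]
      gcongr
      refine (ENNReal.ofReal_le_ofReal hHk).trans (le_of_eq ?_)
      rw [← ENNReal.ofReal_rpow_of_pos (by norm_num)]; norm_num
    rw [hstep]
    calc _ ≤ ∑ i, ‖c' i * (fwdDiff H)^[l] (splineFamily l (i.1, (i.2 : Fin n → ℤ))) y‖ₑ :=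
          enorm_sum_le _ _
      _ ≤ ∑ i, ((K i).toNNReal : ℝ≥0∞) * ((C * e) * (2 : ℝ≥0∞) ^ ((l : ℝ) * ((j : ℝ) - k))) := by
          refine Finset.sum_le_sum fun i _ => ?_
          rw [enorm_mul]
          have h1 : ‖c' i‖ₑ ≤ C * e := by
            refine le_trans ?_ hc'
            rw [enorm_le_iff_norm_le]
            exact norm_le_pi_norm c' i
          have h2 : ‖(fwdDiff H)^[l] (splineFamily l (i.1, (i.2 : Fin n → ℤ))) y‖ₑ ≤
              ((K i).toNNReal : ℝ≥0∞) * (2 : ℝ≥0∞) ^ ((l : ℝ) * ((j : ℝ) - k)) := by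
            rw [Real.enorm_eq_ofReal_abs]
            refine (ENNReal.ofReal_le_ofReal (hK i l le_rfl H y hH1 hy1)).trans ?_
            rw [ENNReal.ofReal_mul (hK0 i)]
            exact mul_le_mul' le_rfl hpow
          calc _ ≤ (C * e) * (((K i).toNNReal : ℝ≥0∞) *
                (2 : ℝ≥0∞) ^ ((l : ℝ) * ((j : ℝ) - k))) := mul_le_mul' h1 h2
            _ = _ := by ring
      _ = _ := by
          rw [← Finset.sum_mul, hKt]
          push_cast
          ring
  refine (delta_le_of_bound hpt).trans (le_of_eq ?_)
  rw [← hD]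
  push_cast
  ring

end expansion

/-! ### Weights -/

section weights

variable {n : ℕ} {α₁ α₂ α₃ : ℝ} {σ₁ p : ℝ≥0∞} {c₁ c₂ : ℝ} {t : ℕ → (Fin n → ℝ) → ℝ}

/-- Index of the dyadic cube `d` levels above containing the cube with index `m`. -/
def parent (d : ℕ) (m : Fin n → ℤ) : Fin n → ℤ := fun i => m i / 2 ^ d

theorem dyadicCube_subset_parent {j k : ℕ} (hjk : j ≤ k) (m : Fin n → ℤ) :
    dyadicCube k m ⊆ dyadicCube j (parent (k - j) m) := by
  obtain ⟨d, rfl⟩ := Nat.exists_eq_add_of_le hjk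
  rw [Nat.add_sub_cancel_left]
  intro x hx
  rw [mem_dyadicCube] at hx ⊢
  intro i
  obtain ⟨h1, h2⟩ := hx i
  have hd : (0 : ℤ) < 2 ^ d := by positivity
  have h3 : parent d m i * 2 ^ d ≤ m i := Int.ediv_mul_le _ hd.ne'
  have h4 : m i + 1 ≤ (parent d m i + 1) * 2 ^ d := Int.lt_ediv_add_one_mul_self _ hd
  have h3' : (parent d m i : ℝ) * 2 ^ d ≤ m i := by exact_mod_cast h3
  have h4' : (m i : ℝ) + 1 ≤ (parent d m i + 1) * 2 ^ d := by exact_mod_cast h4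
  have hd' : (0 : ℝ) < 2 ^ d := by positivity
  rw [pow_add] at h1 h2
  constructor
  · refine lt_of_mul_lt_mul_right ?_ hd'.le
    linarith
  · refine lt_of_mul_lt_mul_right ?_ hd'.le
    linarith

theorem eq_floor_of_mem_dyadicCube {k : ℕ} {m : Fin n → ℤ} {x : Fin n → ℝ}
    (hx : x ∈ dyadicCube k m) : m = fun i => ⌊2 ^ k * x i⌋ := by
  funext i
  have := mem_dyadicCube.1 hx i
  exact (Int.floor_eq_iff.2 ⟨this.1.le, this.2⟩).symm

theorem mem_dyadicCubeHalfOpen_iff {k : ℕ} {m m' : Fin n → ℤ} {x : Fin n → ℝ}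
    (hx : x ∈ dyadicCube k m) : x ∈ dyadicCubeHalfOpen k m' ↔ m' = m := by
  have h2 : (0 : ℝ) < 2 ^ k := by positivity
  have hmem : x ∈ dyadicCubeHalfOpen k m' ↔
      ∀ i, (m' i : ℝ) ≤ 2 ^ k * x i ∧ 2 ^ k * x i < m' i + 1 := by
    simp only [dyadicCubeHalfOpen, Set.mem_univ_pi, Set.mem_Ico]
    refine forall_congr' fun i => ?_
    rw [div_le_iff₀' h2, lt_div_iff₀' h2]
  rw [hmem, eq_floor_of_mem_dyadicCube hx]
  constructor
  · intro h; funext i; exact (Int.floor_eq_iff.2 (h i)).symm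
  · rintro rfl i; exact ⟨Int.floor_le _, Int.lt_floor_add_one _⟩

theorem assocWeight_of_mem {k : ℕ} {m : Fin n → ℤ} {x : Fin n → ℝ} (hx : x ∈ dyadicCube k m) :
    assocWeight p t k x = scale n k p * assoc p t k m := by
  rw [assocWeight, tsum_eq_single m]
  · rw [Set.indicator_of_mem ((mem_dyadicCubeHalfOpen_iff hx).2 rfl)]
  · intro m' hm'
    rw [Set.indicator_of_notMem fun h => hm' ((mem_dyadicCubeHalfOpen_iff hx).1 h)]

theorem scale_mul_volume_rpow (k : ℕ) (m : Fin n → ℤ) :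
    scale n k p * volume (dyadicCube k m) ^ (1 / p.toReal) = 1 := by
  rw [dyadicCube, volume_openCube, scale, ← ENNReal.rpow_mul, ← two_rpow_add]
  convert ENNReal.rpow_zero using 2
  ring

/-- The step weight has the same `L_p` norm as `t k` on each cube of its own level, so sums of the
`t_{k,m}` can be read as integrals of the step weight over coarser cubes. -/
theorem eLpNorm_assocWeight (hp : p ≠ 0) (k : ℕ) (m : Fin n → ℤ) :
    eLpNorm (assocWeight p t k) p (volume.restrict (dyadicCube k m)) = assoc p t k m := by
  have h1 : assocWeight p t k =ᵐ[volume.restrict (dyadicCube k m)]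
      fun _ => scale n k p * assoc p t k m :=
    (ae_restrict_iff' (measurableSet_dyadicCube k m)).2
      (Filter.Eventually.of_forall fun x hx => assocWeight_of_mem hx)
  have hne : volume.restrict (dyadicCube k m) ≠ 0 := by
    rw [Ne, Measure.restrict_eq_zero, dyadicCube, volume_openCube]
    simp
  rw [eLpNorm_congr_ae h1, eLpNorm_const _ hp hne, Measure.restrict_apply_univ, enorm_eq_self,
    mul_right_comm, scale_mul_volume_rpow, one_mul]

theorem cubeMean_assocWeight (hp : p ≠ 0) (k : ℕ) (m : Fin n → ℤ) :
    cubeMean k m p (assocWeight p t k) = scale n k p * assoc p t k m := by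
  rw [cubeMean, eLpNorm_assocWeight hp]

/-- The descendants of a cube are pairwise disjoint subcubes: additivity of the integral gives the
case `p < ∞`, monotonicity the case `p = ∞`. -/
theorem seqNorm_fibre_le_eLpNorm (hp : p ≠ 0) {j k : ℕ} (hjk : j ≤ k) (M : Fin n → ℤ) :
    seqNorm p (fun m : {m // parent (k - j) m = M} => assoc p t k m) ≤
      eLpNorm (assocWeight p t k) p (volume.restrict (dyadicCube j M)) := by
  have hsub : ∀ m : {m // parent (k - j) m = M}, dyadicCube k (m : Fin n → ℤ) ⊆ dyadicCube j M := by
    rintro ⟨m, rfl⟩; exact dyadicCube_subset_parent hjk m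
  unfold seqNorm
  split_ifs with h
  · refine iSup_le fun m => ?_
    simp only
    rw [← eLpNorm_assocWeight hp]
    exact eLpNorm_mono_measure _ (Measure.restrict_mono (hsub m) le_rfl)
  · have hp' := ENNReal.toReal_pos hp h
    rw [eLpNorm_eq_lintegral_rpow_enorm_toReal hp h]
    refine ENNReal.rpow_le_rpow ?_ (by positivity)
    have h1 : ∀ m : {m // parent (k - j) m = M}, assoc p t k m ^ p.toReal =
        ∫⁻ x in dyadicCube k (m : Fin n → ℤ), ‖assocWeight p t k x‖ₑ ^ p.toReal := by
      intro m
      rw [← eLpNorm_assocWeight hp, eLpNorm_eq_lintegral_rpow_enorm_toReal hp h,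
        ← ENNReal.rpow_mul, one_div_mul_cancel hp'.ne', ENNReal.rpow_one]
    rw [tsum_congr h1, ← lintegral_iUnion (fun m => measurableSet_dyadicCube k _)]
    · exact lintegral_mono' (Measure.restrict_mono (Set.iUnion_subset hsub) le_rfl) le_rfl
    · intro a b hab
      refine Set.disjoint_left.2 fun x hxa hxb => hab (Subtype.ext ?_)
      rw [eq_floor_of_mem_dyadicCube hxa, eq_floor_of_mem_dyadicCube hxb]

theorem scale_ne_zero (k : ℕ) : scale n k p ≠ 0 := by simp [scale]

theorem scale_ne_top (k : ℕ) : scale n k p ≠ ∞ := by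
  simp [scale, ENNReal.rpow_eq_top_iff]

theorem IsXClass.assoc_ne_top (hX : IsXClass α₁ α₂ α₃ σ₁ p p c₁ c₂ t) (k : ℕ) (m : Fin n → ℤ) :
    assoc p t k m ≠ ∞ := by
  have hK : IsCompact (Set.univ.pi fun i : Fin n =>
      Set.Icc (corner k m i) (corner k m i + (2 ^ k : ℝ)⁻¹)) :=
    isCompact_univ_pi fun _ => isCompact_Icc
  refine ne_top_of_le_ne_top (hX.admissible k _ hK).eLpNorm_lt_top.ne
    (eLpNorm_mono_measure _ (Measure.restrict_mono ?_ le_rfl))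
  exact Set.pi_mono fun i _ => Set.Ioo_subset_Icc_self

/-- This is the second class condition with `σ₂ = p`: both means carry the same normalization
`2^{jn/p}`, which cancels, and `t_{j,M}` is positive and finite. -/
theorem IsXClass.seqNorm_fibre_le (hX : IsXClass α₁ α₂ α₃ σ₁ p p c₁ c₂ t) (hp : p ≠ 0) {j k : ℕ}
    (hjk : j ≤ k) (M : Fin n → ℤ) :
    seqNorm p (fun m : {m // parent (k - j) m = M} => assoc p t k m) ≤
      ENNReal.ofReal c₂ * (2 : ℝ≥0∞) ^ (α₂ * ((k : ℝ) - j)) * assoc p t j M := by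
  have h := hX.upper j k M hjk
  rw [cubeMean_assocWeight hp, cubeMean,
    ENNReal.mul_inv (Or.inl (scale_ne_zero j)) (Or.inl (scale_ne_top j)), mul_mul_mul_comm,
    ENNReal.inv_mul_cancel (scale_ne_zero j) (scale_ne_top j), one_mul, mul_comm,
    ← div_eq_mul_inv, ENNReal.div_le_iff (hX.assoc_pos j M).ne' (hX.assoc_ne_top j M)] at h
  exact (seqNorm_fibre_le_eLpNorm hp hjk M).trans h

/-- Passing from level `k` to the coarser level `j` in weighted sums. -/
theorem IsXClass.seqNorm_parent_le (hX : IsXClass α₁ α₂ α₃ σ₁ p p c₁ c₂ t) (hp : p ≠ 0) {j k : ℕ}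
    (hjk : j ≤ k) (b : (Fin n → ℤ) → ℝ≥0∞) :
    seqNorm p (fun m => assoc p t k m * b (parent (k - j) m)) ≤
      ENNReal.ofReal c₂ * (2 : ℝ≥0∞) ^ (α₂ * ((k : ℝ) - j)) *
        seqNorm p (fun M => assoc p t j M * b M) := by
  have hf := hX.seqNorm_fibre_le hp hjk
  set D := ENNReal.ofReal c₂ * (2 : ℝ≥0∞) ^ (α₂ * ((k : ℝ) - j))
  rw [← seqNorm_const_mul hp]
  unfold seqNorm at hf ⊢
  split_ifs at hf ⊢ with h
  · refine iSup_le fun m => ?_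
    refine le_trans ?_ (le_iSup (fun M => D * (assoc p t j M * b M)) (parent (k - j) m))
    simp only
    rw [← mul_assoc]
    refine mul_le_mul_left ?_ _
    exact (le_iSup (fun m' : {m' // parent (k - j) m' = parent (k - j) m} => assoc p t k m')
      ⟨m, rfl⟩).trans (hf _)
  · have hp' := ENNReal.toReal_pos hp h
    refine ENNReal.rpow_le_rpow ?_ (by positivity)
    -- The sum is grouped by ancestors; `b` is constant on each group.
    rw [← (Equiv.sigmaFiberEquiv (parent (n := n) (k - j))).tsum_eq, ENNReal.tsum_sigma']
    simp only
    refine ENNReal.tsum_le_tsum fun M => ?_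
    have h1 : ∀ m : {m // parent (k - j) m = M},
        (assoc p t k (Equiv.sigmaFiberEquiv (parent (n := n) (k - j)) ⟨M, m⟩) *
          b (parent (k - j) (Equiv.sigmaFiberEquiv (parent (n := n) (k - j)) ⟨M, m⟩))) ^ p.toReal =
        assoc p t k m ^ p.toReal * b M ^ p.toReal := by
      rintro ⟨m, rfl⟩
      rw [← ENNReal.mul_rpow_of_nonneg _ _ hp'.le]; rfl
    rw [tsum_congr h1, ENNReal.tsum_mul_right, ← mul_assoc, ENNReal.mul_rpow_of_nonneg _ _ hp'.le]
    gcongr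
    have := ENNReal.rpow_le_rpow (hf M) hp'.le
    rwa [← ENNReal.rpow_mul, one_div_mul_cancel hp'.ne', ENNReal.rpow_one] at this

/-- Walk from `m` to `m + i` in `a` moves that change each coordinate by at most `1`; each move
costs `2^{α₃}`. -/
theorem IsXClass.assoc_le_shift (hX : IsXClass α₁ α₂ α₃ σ₁ p p c₁ c₂ t) (k a : ℕ)
    (m i : Fin n → ℤ) (hi : ∀ c, |i c| ≤ a) :
    assoc p t k m ≤ ((2 : ℝ≥0∞) ^ α₃) ^ a * assoc p t k (m + i) := by
  induction a generalizing i with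
  | zero =>
    have : i = 0 := by funext c; simpa using hi c
    simp [this]
  | succ a ih =>
    have hsplit : ∀ z : ℤ, |z| ≤ (a + 1 : ℕ) → ∃ w : ℤ, |w| ≤ a ∧ |w - z| ≤ 1 := by
      intro z hz
      rw [abs_le] at hz
      push_cast at hz
      rcases lt_trichotomy z 0 with h | h | h
      · exact ⟨z + 1, abs_le.2 ⟨by omega, by omega⟩, by simp⟩
      · exact ⟨0, by simp, by simp [h]⟩
      · exact ⟨z - 1, abs_le.2 ⟨by omega, by omega⟩, by simp⟩
    choose w hw1 hw2 using fun c => hsplit (i c) (hi c)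
    refine (ih w hw1).trans ?_
    rw [pow_succ, mul_assoc]
    gcongr
    exact hX.neighbour k _ _ fun c => by simpa using hw2 c

theorem IsXClass.seqNorm_rpow_le_of_shift (hX : IsXClass α₁ α₂ α₃ σ₁ p p c₁ c₂ t) {μ : ℝ}
    (hμ : 0 < μ) (hμp : ENNReal.ofReal μ ≤ p) (l k : ℕ) (F a : (Fin n → ℤ) → ℝ≥0∞) (D : ℝ≥0∞)
    (hF : ∀ m, F m ^ μ ≤ D * ∑ i ∈ shiftBox n l, a (m + i) ^ μ) :
    seqNorm p (fun m => assoc p t k m * F m) ^ μ ≤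
      D * ((shiftBox n l).card * (((2 : ℝ≥0∞) ^ α₃) ^ l) ^ μ) *
        seqNorm p (fun m => assoc p t k m * a m) ^ μ := by
  have hp : p ≠ 0 := by
    rintro rfl; simp at hμp; linarith
  have hD : (D ^ (1 / μ)) ^ μ = D := by
    rw [← ENNReal.rpow_mul, one_div_mul_cancel hμ.ne', ENNReal.rpow_one]
  set E := ((2 : ℝ≥0∞) ^ α₃) ^ l
  have h1 := seqNorm_rpow_le_sum hμ hμp (shiftBox n l) (fun m => assoc p t k m * F m)
    -- The weight is carried along to the shifted cube at cost `E`, so that each summand is a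
    -- translate of one sequence; `D ^ (1 / μ)` becomes `D` after taking `μ`-th powers.
    (fun i m => (D ^ (1 / μ) * E) * (assoc p t k (m + i) * a (m + i))) (fun m => by
      rw [ENNReal.mul_rpow_of_nonneg _ _ hμ.le]
      refine (mul_le_mul_right (hF m) _).trans ?_
      rw [mul_left_comm, Finset.mul_sum, Finset.mul_sum]
      refine Finset.sum_le_sum fun i hi => ?_
      rw [mul_assoc, ENNReal.mul_rpow_of_nonneg (D ^ (1 / μ)) _ hμ.le, hD, ← mul_assoc E,
        ENNReal.mul_rpow_of_nonneg _ (a (m + i)) hμ.le]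
      gcongr
      exact hX.assoc_le_shift k l m i (mem_shiftBox.1 hi))
  refine h1.trans (le_of_eq ?_)
  have h2 : ∀ i ∈ shiftBox n l, seqNorm p (fun m => (D ^ (1 / μ) * E) *
      (assoc p t k (m + i) * a (m + i))) ^ μ =
      D * E ^ μ * seqNorm p (fun m => assoc p t k m * a m) ^ μ := by
    intro i _
    have h3 := seqNorm_comp_equiv (p := p) (Equiv.addRight i) (fun m => assoc p t k m * a m)
    simp only [Equiv.coe_addRight] at h3
    rw [seqNorm_const_mul hp, h3, ENNReal.mul_rpow_of_nonneg _ _ hμ.le,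
      ENNReal.mul_rpow_of_nonneg _ _ hμ.le, hD]
  rw [Finset.sum_congr rfl h2, Finset.sum_const, nsmul_eq_mul]
  ring

end weights

/-! ### Weighted norms and telescoping -/

section assembly

variable {n : ℕ} {α₁ α₂ α₃ : ℝ} {σ₁ p r : ℝ≥0∞} {c₁ c₂ : ℝ} {t : ℕ → (Fin n → ℝ) → ℝ} {μ : ℝ}

/-- The weighted norm of level `k` underlying `splineApprox`. -/
noncomputable def levelNorm (r p : ℝ≥0∞) (t : ℕ → (Fin n → ℝ) → ℝ) (k : ℕ)
    (ψ : (Fin n → ℝ) → ℝ) : ℝ≥0∞ :=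
  seqNorm p fun m : Fin n → ℤ =>
    assoc p t k m * (scale n k r * eLpNorm ψ r (volume.restrict (dyadicCube k m)))

/-- The weighted norm of the differences of order `l` at level `k`. -/
noncomputable def diffNorm (l : ℕ) (r p : ℝ≥0∞) (t : ℕ → (Fin n → ℝ) → ℝ) (k : ℕ)
    (ψ : (Fin n → ℝ) → ℝ) : ℝ≥0∞ :=
  seqNorm p fun m : Fin n → ℤ => assoc p t k m * delta l r (corner k m) ((2 ^ k : ℝ)⁻¹) ψ

theorem splineApproxInit_eq (φ : (Fin n → ℝ) → ℝ) :
    splineApproxInit r p t φ = levelNorm r p t 0 φ := by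
  simp [splineApproxInit, levelNorm, scale]

theorem LocLp.aestronglyMeasurable {φ : (Fin n → ℝ) → ℝ} (hφ : LocLp φ r) :
    AEStronglyMeasurable φ volume := by
  have h : AEStronglyMeasurable φ (volume.restrict (⋃ N : ℕ, Metric.closedBall 0 (N : ℝ))) :=
    aestronglyMeasurable_iUnion_iff.2 fun N => (hφ _ (isCompact_closedBall 0 (N : ℝ))).1
  rwa [Metric.iUnion_closedBall_nat, Measure.restrict_univ] at h

theorem levelNorm_sub_rpow_le (hμ : 0 < μ) (hμ1 : μ ≤ 1) (hμr : ENNReal.ofReal μ ≤ r)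
    (hμp : ENNReal.ofReal μ ≤ p) (k : ℕ) {f g : (Fin n → ℝ) → ℝ}
    (hf : AEStronglyMeasurable f volume) (hg : AEStronglyMeasurable g volume) :
    levelNorm r p t k (fun x => f x - g x) ^ μ ≤
      levelNorm r p t k f ^ μ + levelNorm r p t k g ^ μ := by
  have := seqNorm_rpow_le_sum hμ hμp (Finset.univ : Finset Bool)
    (fun m => assoc p t k m * (scale n k r *
      eLpNorm (fun x => f x - g x) r (volume.restrict (dyadicCube k m))))
    (fun b m => assoc p t k m * (scale n k r *
      eLpNorm (if b then f else g) r (volume.restrict (dyadicCube k m)))) (fun m => by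
      simp only [Fintype.univ_bool, Finset.mem_singleton, Bool.true_eq_false, not_false_eq_true,
        Finset.sum_insert, Finset.sum_singleton, if_true, Bool.false_eq_true, if_false,
        ENNReal.mul_rpow_of_nonneg _ _ hμ.le, ← mul_add]
      gcongr
      exact eLpNorm_sub_rpow_le hμ hμ1 hμr hf.restrict hg.restrict)
  simpa [levelNorm] using this

theorem aestronglyMeasurable_fwdDiff {f : (Fin n → ℝ) → ℝ} (hf : AEStronglyMeasurable f volume)
    (l k : ℕ) (m : Fin n → ℤ) :
    AEStronglyMeasurable (fun q : (Fin n → ℝ) × (Fin n → ℝ) => (fwdDiff q.1)^[l] f q.2)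
      (deltaMeasure k m) := by
  simp only [fwdDiff_iter_eq_sum_shift]
  refine Finset.aestronglyMeasurable_fun_sum _ fun j hj => ?_
  simp only [zsmul_eq_mul]
  exact (eLpNorm_shift_le (r := 1) m
    (by simpa [Nat.lt_succ_iff] using hj : j ≤ l) hf).1.const_mul _

theorem diffNorm_add_rpow_le (hμ : 0 < μ) (hμ1 : μ ≤ 1) (hμr : ENNReal.ofReal μ ≤ r)
    (hμp : ENNReal.ofReal μ ≤ p) (l k : ℕ) {f g : (Fin n → ℝ) → ℝ}
    (hf : AEStronglyMeasurable f volume) (hg : AEStronglyMeasurable g volume) :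
    diffNorm l r p t k (f + g) ^ μ ≤ diffNorm l r p t k f ^ μ + diffNorm l r p t k g ^ μ := by
  have hd : ∀ m, delta l r (corner k m) ((2 ^ k : ℝ)⁻¹) (f + g) ^ μ ≤
      delta l r (corner k m) ((2 ^ k : ℝ)⁻¹) f ^ μ +
        delta l r (corner k m) ((2 ^ k : ℝ)⁻¹) g ^ μ := by
    intro m
    simp only [delta_eq, ENNReal.mul_rpow_of_nonneg _ _ hμ.le, ← mul_add]
    gcongr
    have h1 := eLpNorm_real_rpow_le_sum (ν := deltaMeasure k m) hμ hμ1 hμr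
      (Finset.univ : Finset Bool)
      (fun q : (Fin n → ℝ) × (Fin n → ℝ) => (fwdDiff q.1)^[l] (f + g) q.2)
      (fun b q => (fwdDiff q.1)^[l] (if b then f else g) q.2)
      (by rintro (_ | _) _ <;> simpa using aestronglyMeasurable_fwdDiff (by assumption) l k m)
      (Filter.Eventually.of_forall fun q => by
        rw [fwdDiff_iter_add]; simpa using enorm_add_le _ _)
    simpa using h1
  have := seqNorm_rpow_le_sum hμ hμp (Finset.univ : Finset Bool)
    (fun m => assoc p t k m * delta l r (corner k m) ((2 ^ k : ℝ)⁻¹) (f + g))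
    (fun b m => assoc p t k m * delta l r (corner k m) ((2 ^ k : ℝ)⁻¹) (if b then f else g))
    (fun m => by
      simp only [Fintype.univ_bool, Finset.mem_singleton, Bool.true_eq_false, not_false_eq_true,
        Finset.sum_insert, Finset.sum_singleton, if_true, Bool.false_eq_true, if_false,
        ENNReal.mul_rpow_of_nonneg _ _ hμ.le, ← mul_add]
      gcongr
      exact hd m)
  simpa [diffNorm] using this

theorem IsXClass.seqNorm_nearBox_rpow_le (hX : IsXClass α₁ α₂ α₃ σ₁ p p c₁ c₂ t) (hμ : 0 < μ)
    (hμ1 : μ ≤ 1) (hμr : ENNReal.ofReal μ ≤ r) (hμp : ENNReal.ofReal μ ≤ p) (l k : ℕ)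
    {ψ : (Fin n → ℝ) → ℝ} (hψ : AEStronglyMeasurable ψ volume) (F : (Fin n → ℤ) → ℝ≥0∞)
    (D : ℝ≥0∞)
    (hF : ∀ m, F m ^ μ ≤
      D * (scale n k r * eLpNorm ψ r (volume.restrict (nearBox l k m))) ^ μ) :
    seqNorm p (fun m => assoc p t k m * F m) ^ μ ≤
      D * ((shiftBox n l).card * (((2 : ℝ≥0∞) ^ α₃) ^ l) ^ μ) * levelNorm r p t k ψ ^ μ := by
  refine hX.seqNorm_rpow_le_of_shift hμ hμp l k _
    (fun m => scale n k r * eLpNorm ψ r (volume.restrict (dyadicCube k m))) _ fun m => ?_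
  refine (hF m).trans (mul_le_mul_right ?_ _)
  simp only [ENNReal.mul_rpow_of_nonneg _ _ hμ.le, ← Finset.mul_sum]
  gcongr
  exact eLpNorm_nearBox_rpow_le hμ hμ1 hμr hψ l k m

/-- Each cube is enlarged to its parent. This is what allows the error of `S_j` to be measured at
level `j + 1`, where the next increment lives. -/
theorem IsXClass.levelNorm_succ_le (hX : IsXClass α₁ α₂ α₃ σ₁ p p c₁ c₂ t) (hp : p ≠ 0) (j : ℕ)
    (ψ : (Fin n → ℝ) → ℝ) :
    levelNorm r p t (j + 1) ψ ≤
      ENNReal.ofReal c₂ * (2 : ℝ≥0∞) ^ α₂ * 2 ^ ((n : ℝ) / r.toReal) * levelNorm r p t j ψ := by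
  have h := hX.seqNorm_parent_le hp (Nat.le_succ j) (fun M => 2 ^ ((n : ℝ) / r.toReal) *
    (scale n j r * eLpNorm ψ r (volume.restrict (dyadicCube j M))))
  have e1 : ((j.succ : ℕ) : ℝ) - j = 1 := by push_cast; ring
  rw [e1, mul_one] at h
  calc _ ≤ _ := ?_
    _ ≤ _ := h
    _ = _ := by
      simp only [mul_left_comm (assoc p t j _) ((2 : ℝ≥0∞) ^ ((n : ℝ) / r.toReal))]
      rw [seqNorm_const_mul hp, levelNorm]
      ring
  refine seqNorm_mono hp fun m => mul_le_mul_right ?_ _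
  rw [← mul_assoc]
  refine mul_le_mul' (le_of_eq ?_) (eLpNorm_mono_measure _
    (Measure.restrict_mono (dyadicCube_subset_parent (Nat.le_succ j) m) le_rfl))
  rw [scale, scale, ← two_rpow_add]
  congr 1
  push_cast
  ring

theorem shiftConst_ne_top (n l : ℕ) (α₃ : ℝ) (hμ : 0 < μ) :
    ((shiftBox n l).card * (((2 : ℝ≥0∞) ^ α₃) ^ l) ^ μ : ℝ≥0∞) ≠ ∞ := by
  refine ENNReal.mul_ne_top (by simp) (ENNReal.rpow_ne_top_of_nonneg hμ.le (ENNReal.pow_ne_top ?_))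
  simp [ENNReal.rpow_eq_top_iff]

theorem exists_diffNorm_rpow_le_levelNorm (n l : ℕ) (α₃ : ℝ) (hμ : 0 < μ) (hμ1 : μ ≤ 1)
    (hμr : ENNReal.ofReal μ ≤ r) (hμp : ENNReal.ofReal μ ≤ p) :
    ∃ C : ℝ≥0∞, C ≠ ∞ ∧ ∀ (α₁ α₂ : ℝ) (σ₁ : ℝ≥0∞) (c₁ c₂ : ℝ) (t : ℕ → (Fin n → ℝ) → ℝ),
      IsXClass α₁ α₂ α₃ σ₁ p p c₁ c₂ t → ∀ ψ, AEStronglyMeasurable ψ volume → ∀ k,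
      diffNorm l r p t k ψ ^ μ ≤ C * levelNorm r p t k ψ ^ μ := by
  refine ⟨(l + 1 : ℕ) * ((2 : ℝ≥0∞) ^ l * 2 ^ ((n : ℝ) / r.toReal)) ^ μ *
    ((shiftBox n l).card * (((2 : ℝ≥0∞) ^ α₃) ^ l) ^ μ), ?_, ?_⟩
  · refine ENNReal.mul_ne_top (ENNReal.mul_ne_top (ENNReal.natCast_ne_top _)
      (ENNReal.rpow_ne_top_of_nonneg hμ.le (ENNReal.mul_ne_top (by simp) ?_)))
      (shiftConst_ne_top n l α₃ hμ)
    exact ENNReal.rpow_ne_top_of_nonneg (by positivity) (by norm_num)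
  · intro α₁ α₂ σ₁ c₁ c₂ t hX ψ hψ k
    exact hX.seqNorm_nearBox_rpow_le hμ hμ1 hμr hμp l k hψ _ _
      fun m => delta_rpow_le hμ hμ1 hμr hψ l k m

/-- Smoothness gains `2^{l(j-k)}` and the weights lose `2^{α₂(k-j)}`; the product has exponent `(l -
α₂)(j - k)`. -/
theorem exists_diffNorm_expansion_rpow_le (n : ℕ) {l : ℕ} (hl : 1 ≤ l) (α₂ α₃ c₂ : ℝ) (hμ : 0 < μ)
    (hμ1 : μ ≤ 1) (hμr : ENNReal.ofReal μ ≤ r) (hμp : ENNReal.ofReal μ ≤ p) :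
    ∃ C : ℝ≥0∞, C ≠ ∞ ∧ ∀ (α₁ : ℝ) (σ₁ : ℝ≥0∞) (c₁ : ℝ) (t : ℕ → (Fin n → ℝ) → ℝ),
      IsXClass α₁ α₂ α₃ σ₁ p p c₁ c₂ t → ∀ j k : ℕ, j ≤ k → ∀ g, HasLocalExpansion l j g →
      diffNorm l r p t k g ^ μ ≤
        C * (2 : ℝ≥0∞) ^ (((l : ℝ) - α₂) * ((j : ℝ) - k) * μ) * levelNorm r p t j g ^ μ := by
  have hr : r ≠ 0 := by rintro rfl; simp at hμr; linarith
  have hp : p ≠ 0 := by rintro rfl; simp at hμp; linarith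
  obtain ⟨C, hC⟩ := exists_delta_le_of_hasLocalExpansion n hl hr
  refine ⟨(C * ENNReal.ofReal c₂) ^ μ * ((shiftBox n l).card * (((2 : ℝ≥0∞) ^ α₃) ^ l) ^ μ),
    ENNReal.mul_ne_top (ENNReal.rpow_ne_top_of_nonneg hμ.le (ENNReal.mul_ne_top (by simp)
      (by simp))) (shiftConst_ne_top n l α₃ hμ), ?_⟩
  intro α₁ σ₁ c₁ t hX j k hjk g hg
  have hcont := hg.continuous hl
  set b : (Fin n → ℤ) → ℝ≥0∞ := fun M =>
    scale n j r * eLpNorm g r (volume.restrict (nearBox l j M)) with hb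
  have h1 : diffNorm l r p t k g ≤ C * (2 : ℝ≥0∞) ^ ((l : ℝ) * ((j : ℝ) - k)) *
      seqNorm p (fun m => assoc p t k m * b (parent (k - j) m)) := by
    rw [← seqNorm_const_mul hp]
    refine seqNorm_mono hp fun m => ?_
    rw [mul_left_comm]
    gcongr
    exact hC j k hjk m _ (dyadicCube_subset_parent hjk m) g hg
  have h2 := h1.trans (mul_le_mul_right (hX.seqNorm_parent_le hp hjk b) _)
  have h3 := hX.seqNorm_nearBox_rpow_le (r := r) hμ hμ1 hμr hμp l j hcont.aestronglyMeasurable b 1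
    (fun m => by rw [one_mul])
  rw [one_mul] at h3
  refine (ENNReal.rpow_le_rpow h2 hμ.le).trans ?_
  have e : (C : ℝ≥0∞) * (2 : ℝ≥0∞) ^ ((l : ℝ) * ((j : ℝ) - k)) *
      (ENNReal.ofReal c₂ * (2 : ℝ≥0∞) ^ (α₂ * ((k : ℝ) - j)) *
        seqNorm p (fun M => assoc p t j M * b M)) =
      (C * ENNReal.ofReal c₂) * (2 : ℝ≥0∞) ^ (((l : ℝ) - α₂) * ((j : ℝ) - k)) *
        seqNorm p (fun M => assoc p t j M * b M) := by
    have : ((l : ℝ) - α₂) * ((j : ℝ) - k) = (l : ℝ) * ((j : ℝ) - k) + α₂ * ((k : ℝ) - j) := by ring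
    rw [this, two_rpow_add]
    ring
  rw [e, ENNReal.mul_rpow_of_nonneg _ _ hμ.le, ENNReal.mul_rpow_of_nonneg _ _ hμ.le,
    ← ENNReal.rpow_mul]
  refine (mul_le_mul_right h3 _).trans (le_of_eq ?_)
  ring

/-- Differences of the consecutive terms of a sequence, starting with the zeroth term. -/
def increment (S : ℕ → (Fin n → ℝ) → ℝ) : ℕ → (Fin n → ℝ) → ℝ
  | 0 => S 0
  | j + 1 => fun x => S (j + 1) x - S j x

/-- The two splines belong to consecutive levels, but both expand at the finer one. -/
theorem hasLocalExpansion_increment {l : ℕ} {S : ℕ → (Fin n → ℝ) → ℝ}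
    (hS : ∀ j, S j ∈ splineSpace n l j) (j : ℕ) : HasLocalExpansion l j (increment S j) := by
  cases j with
  | zero => exact hasLocalExpansion_of_mem (hS 0)
  | succ j => exact (hasLocalExpansion_of_mem (hS _)).sub (hasLocalExpansion_succ_of_mem (hS j))

theorem diffNorm_rpow_le_sum_increment (hμ : 0 < μ) (hμ1 : μ ≤ 1) (hμr : ENNReal.ofReal μ ≤ r)
    (hμp : ENNReal.ofReal μ ≤ p) (l k : ℕ) {S : ℕ → (Fin n → ℝ) → ℝ}
    (hS : ∀ j, AEStronglyMeasurable (S j) volume) (J : ℕ) :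
    diffNorm l r p t k (S J) ^ μ ≤
      ∑ j ∈ Finset.range (J + 1), diffNorm l r p t k (increment S j) ^ μ := by
  induction J with
  | zero => simp [increment]
  | succ J ih =>
    rw [Finset.sum_range_succ]
    have hadd : S (J + 1) = S J + increment S (J + 1) := by
      funext x; simp [increment]
    have h := diffNorm_add_rpow_le (t := t) hμ hμ1 hμr hμp l k (hS J)
      (g := increment S (J + 1)) ((hS (J + 1)).sub (hS J))
    rw [← hadd] at h
    exact h.trans (by gcongr)

theorem exists_diffNorm_rpow_le_of_splines (n : ℕ) {l : ℕ} (hl : 1 ≤ l) (α₂ α₃ c₂ : ℝ) (hμ : 0 < μ)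
    (hμ1 : μ ≤ 1) (hμr : ENNReal.ofReal μ ≤ r) (hμp : ENNReal.ofReal μ ≤ p) :
    ∃ C : ℝ≥0∞, C ≠ ∞ ∧ ∀ (α₁ : ℝ) (σ₁ : ℝ≥0∞) (c₁ : ℝ) (t : ℕ → (Fin n → ℝ) → ℝ),
      IsXClass α₁ α₂ α₃ σ₁ p p c₁ c₂ t → ∀ φ : (Fin n → ℝ) → ℝ, AEStronglyMeasurable φ volume →
      ∀ S : ℕ → (Fin n → ℝ) → ℝ, (∀ j, S j ∈ splineSpace n l j) → ∀ k : ℕ,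
      diffNorm l r p t k φ ^ μ ≤ C * ((2 : ℝ≥0∞) ^ (-(k : ℝ) * ((l : ℝ) - α₂) * μ) *
        ((2 : ℝ≥0∞) ^ ((-1 : ℝ) * ((l : ℝ) - α₂) * μ) * levelNorm r p t 0 φ ^ μ +
          ∑ j ∈ Finset.range (k + 1), (2 : ℝ≥0∞) ^ ((j : ℝ) * ((l : ℝ) - α₂) * μ) *
            levelNorm r p t j (fun x => φ x - S j x) ^ μ)) := by
  have hp : p ≠ 0 := by rintro rfl; simp at hμp; linarith
  obtain ⟨C₁, hC₁, H₁⟩ := exists_diffNorm_rpow_le_levelNorm (r := r) n l α₃ hμ hμ1 hμr hμp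
  obtain ⟨C₂, hC₂, H₂⟩ := exists_diffNorm_expansion_rpow_le (r := r) n hl α₂ α₃ c₂ hμ hμ1 hμr hμp
  set lam : ℝ := (l : ℝ) - α₂ with hlam
  set C₃ : ℝ≥0∞ := (ENNReal.ofReal c₂ * (2 : ℝ≥0∞) ^ α₂ * 2 ^ ((n : ℝ) / r.toReal)) ^ μ with hC₃
  have two_ne_top : ∀ x : ℝ, (2 : ℝ≥0∞) ^ x ≠ ∞ := fun x => by simp [ENNReal.rpow_eq_top_iff]
  have hC₃t : C₃ ≠ ∞ := ENNReal.rpow_ne_top_of_nonneg hμ.le (ENNReal.mul_ne_top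
    (ENNReal.mul_ne_top ENNReal.ofReal_ne_top (two_ne_top _)) (two_ne_top _))
  -- `C₁` comes from the remainder and `C₂` from the increments. An increment of level `j + 1` meets
  -- the error of level `j + 1` with factor `1` and that of level `j` with `C₃`, and `2 ^ (lam * μ)`
  -- adjusts the dyadic weight from `j + 1` to `j`, also in the step from `0` to `-1`.
  refine ⟨C₁ + C₂ * (2 ^ (lam * μ) * (1 + C₃) + 1), ENNReal.add_ne_top.2 ⟨hC₁, ENNReal.mul_ne_top hC₂
    (ENNReal.add_ne_top.2 ⟨ENNReal.mul_ne_top (two_ne_top _) (by simp [hC₃t]), by simp⟩)⟩, ?_⟩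
  intro α₁ σ₁ c₁ t hX φ hφ S hS k
  have hSm : ∀ j, AEStronglyMeasurable (S j) volume := fun j =>
    ((hasLocalExpansion_of_mem (hS j)).continuous hl).aestronglyMeasurable
  set e : ℕ → ℝ≥0∞ := fun j => levelNorm r p t j (fun x => φ x - S j x) ^ μ with he
  set T : ℕ → ℝ≥0∞ := fun j => (2 : ℝ≥0∞) ^ ((j : ℝ) * lam * μ) * e j with hT
  set I : ℝ≥0∞ := (2 : ℝ≥0∞) ^ ((-1 : ℝ) * lam * μ) * levelNorm r p t 0 φ ^ μ with hI
  set A : ℝ≥0∞ := (2 : ℝ≥0∞) ^ (-(k : ℝ) * lam * μ) with hA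
  have hsplit : diffNorm l r p t k φ ^ μ ≤ diffNorm l r p t k (fun x => φ x - S k x) ^ μ +
      ∑ j ∈ Finset.range (k + 1), diffNorm l r p t k (increment S j) ^ μ := by
    have h := diffNorm_add_rpow_le (t := t) hμ hμ1 hμr hμp l k (f := fun x => φ x - S k x)
      (hφ.sub (hSm k)) (hSm k)
    have hadd : (fun x => φ x - S k x) + S k = φ := by funext x; simp
    rw [hadd] at h
    exact h.trans (by gcongr; exact diffNorm_rpow_le_sum_increment hμ hμ1 hμr hμp l k hSm k)
  have hfirst : diffNorm l r p t k (fun x => φ x - S k x) ^ μ ≤ C₁ * (A * T k) := by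
    refine (H₁ α₁ α₂ σ₁ c₁ c₂ t hX _ (hφ.sub (hSm k)) k).trans (le_of_eq ?_)
    congr 1
    simp only [hA, hT]
    have : -(k : ℝ) * lam * μ + (k : ℝ) * lam * μ = 0 := by ring
    rw [← mul_assoc, ← two_rpow_add, this, ENNReal.rpow_zero, one_mul]
    rfl
  have hterm : ∀ j ≤ k, diffNorm l r p t k (increment S j) ^ μ ≤
      C₂ * (A * ((2 : ℝ≥0∞) ^ ((j : ℝ) * lam * μ) * levelNorm r p t j (increment S j) ^ μ)) := by
    intro j hj
    refine (H₂ α₁ σ₁ c₁ t hX j k hj _ (hasLocalExpansion_increment hS j)).trans (le_of_eq ?_)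
    have : lam * ((j : ℝ) - k) * μ = -(k : ℝ) * lam * μ + (j : ℝ) * lam * μ := by ring
    rw [this, two_rpow_add]
    ring
  have hw0 : (2 : ℝ≥0∞) ^ (((0 : ℕ) : ℝ) * lam * μ) * levelNorm r p t 0 (increment S 0) ^ μ ≤
      2 ^ (lam * μ) * I + T 0 := by
    have h := levelNorm_sub_rpow_le (t := t) hμ hμ1 hμr hμp 0 hφ (hφ.sub (hSm 0))
    have hsub : (fun x => φ x - (φ - S 0) x) = increment S 0 := by funext x; simp [increment]
    rw [hsub] at h
    have hI' : (2 : ℝ≥0∞) ^ (lam * μ) * I = levelNorm r p t 0 φ ^ μ := by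
      rw [hI, ← mul_assoc, ← two_rpow_add]
      have : lam * μ + (-1 : ℝ) * lam * μ = 0 := by ring
      rw [this, ENNReal.rpow_zero, one_mul]
    rw [hI', hT]
    simp only [Nat.cast_zero, zero_mul, ENNReal.rpow_zero, one_mul]
    exact h
  have hwj : ∀ j, (2 : ℝ≥0∞) ^ (((j + 1 : ℕ) : ℝ) * lam * μ) *
      levelNorm r p t (j + 1) (increment S (j + 1)) ^ μ ≤
      2 ^ (lam * μ) * C₃ * T j + T (j + 1) := by
    intro j
    have h := levelNorm_sub_rpow_le (t := t) hμ hμ1 hμr hμp (j + 1) (hφ.sub (hSm j))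
      (hφ.sub (hSm (j + 1)))
    have hsub : (fun x => (φ - S j) x - (φ - S (j + 1)) x) = increment S (j + 1) := by
      funext x; simp [increment]
    rw [hsub] at h
    have h' : levelNorm r p t (j + 1) (φ - S j) ^ μ ≤ C₃ * e j := by
      rw [hC₃, he, ← ENNReal.mul_rpow_of_nonneg _ _ hμ.le]
      exact ENNReal.rpow_le_rpow (hX.levelNorm_succ_le hp j _) hμ.le
    refine (mul_le_mul_right (h.trans (add_le_add h' le_rfl)) _).trans (le_of_eq ?_)
    rw [mul_add]
    congr 1
    have : ((j + 1 : ℕ) : ℝ) * lam * μ = lam * μ + (j : ℝ) * lam * μ := by push_cast; ring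
    rw [this, two_rpow_add, hT]
    ring
  have hsum : ∑ j ∈ Finset.range (k + 1), diffNorm l r p t k (increment S j) ^ μ ≤
      C₂ * (A * ((2 ^ (lam * μ) * (1 + C₃) + 1) * (I + ∑ j ∈ Finset.range (k + 1), T j))) := by
    refine (Finset.sum_le_sum fun j hj => hterm j (by simpa [Nat.lt_succ_iff] using hj)).trans ?_
    rw [← Finset.mul_sum, ← Finset.mul_sum]
    gcongr
    -- The increment of index `0` is split off, since it is compared with the initial term and not
    -- with a coarser error.
    rw [Finset.sum_range_succ']
    refine (add_le_add (Finset.sum_le_sum fun j _ => hwj j) hw0).trans ?_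
    rw [Finset.sum_add_distrib, ← Finset.mul_sum]
    have hk : ∑ j ∈ Finset.range k, T j ≤ ∑ j ∈ Finset.range (k + 1), T j :=
      Finset.sum_le_sum_of_subset (Finset.range_mono (Nat.le_succ k))
    have hk' : ∑ j ∈ Finset.range (k + 1), T j = ∑ j ∈ Finset.range k, T (j + 1) + T 0 :=
      Finset.sum_range_succ' _ _
    calc _ = 2 ^ (lam * μ) * C₃ * ∑ j ∈ Finset.range k, T j + 2 ^ (lam * μ) * I +
          ∑ j ∈ Finset.range (k + 1), T j := by rw [hk']; ring
      _ ≤ 2 ^ (lam * μ) * C₃ * (I + ∑ j ∈ Finset.range (k + 1), T j) +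
          2 ^ (lam * μ) * (I + ∑ j ∈ Finset.range (k + 1), T j) +
          (I + ∑ j ∈ Finset.range (k + 1), T j) := by
          gcongr
          · exact hk.trans le_add_self
          · exact le_self_add
          · exact le_add_self
      _ = _ := by ring
  have hTk : T k ≤ I + ∑ j ∈ Finset.range (k + 1), T j :=
    (Finset.single_le_sum (f := T) (fun _ _ => zero_le) (by simp)).trans le_add_self
  calc _ ≤ _ := hsplit
    _ ≤ C₁ * (A * (I + ∑ j ∈ Finset.range (k + 1), T j)) +
        C₂ * (A * ((2 ^ (lam * μ) * (1 + C₃) + 1) * (I + ∑ j ∈ Finset.range (k + 1), T j))) :=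
      add_le_add (hfirst.trans (by gcongr)) hsum
    _ = _ := by ring

theorem splineSpace_nonempty (n d k : ℕ) : (splineSpace n d k).Nonempty :=
  ⟨fun x => ∑' m : Fin n → ℤ, (0 : ℝ) * tensorSpline d k m x, fun _ => 0, fun _ => rfl⟩

/-- The infimum need not be attained, hence the slack `ε`; if it is infinite, any spline serves. -/
theorem exists_spline_levelNorm_le (l : ℕ) (φ : (Fin n → ℝ) → ℝ) (j : ℕ) {ε : ℝ≥0∞} (hε : 0 < ε) :
    ∃ S ∈ splineSpace n l j,
      levelNorm r p t j (fun x => φ x - S x) ≤ splineApprox (l + 1) r p t φ j + ε := by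
  by_cases h : splineApprox (l + 1) r p t φ j = ∞
  · obtain ⟨S, hS⟩ := splineSpace_nonempty n l j
    exact ⟨S, hS, by simp [h]⟩
  · have hlt := ENNReal.lt_add_right h hε.ne'
    nth_rewrite 1 [splineApprox] at hlt
    simp only [iInf_lt_iff] at hlt
    obtain ⟨S, hS, hlt⟩ := hlt
    exact ⟨S, hS, hlt.le⟩

theorem exists_diffNorm_rpow_le (n : ℕ) {l : ℕ} (hl : 1 ≤ l) (α₂ α₃ c₂ : ℝ) (hμ : 0 < μ)
    (hμ1 : μ ≤ 1) (hμr : ENNReal.ofReal μ ≤ r) (hμp : ENNReal.ofReal μ ≤ p) :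
    ∃ C : ℝ≥0∞, C ≠ ∞ ∧ ∀ (α₁ : ℝ) (σ₁ : ℝ≥0∞) (c₁ : ℝ) (t : ℕ → (Fin n → ℝ) → ℝ),
      IsXClass α₁ α₂ α₃ σ₁ p p c₁ c₂ t → ∀ φ : (Fin n → ℝ) → ℝ, AEStronglyMeasurable φ volume →
      ∀ k : ℕ,
      diffNorm l r p t k φ ^ μ ≤ C * ((2 : ℝ≥0∞) ^ (-(k : ℝ) * ((l : ℝ) - α₂) * μ) *
        ((2 : ℝ≥0∞) ^ ((-1 : ℝ) * ((l : ℝ) - α₂) * μ) * splineApproxInit r p t φ ^ μ +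
          ∑ j ∈ Finset.range (k + 1), (2 : ℝ≥0∞) ^ ((j : ℝ) * ((l : ℝ) - α₂) * μ) *
            splineApprox (l + 1) r p t φ j ^ μ)) := by
  obtain ⟨C, hC, H⟩ := exists_diffNorm_rpow_le_of_splines (r := r) n hl α₂ α₃ c₂ hμ hμ1 hμr hμp
  have two_ne_top : ∀ x : ℝ, (2 : ℝ≥0∞) ^ x ≠ ∞ := fun x => by simp [ENNReal.rpow_eq_top_iff]
  refine ⟨C, hC, fun α₁ σ₁ c₁ t hX φ hφ k => ?_⟩
  have hε : ∀ N : ℕ, diffNorm l r p t k φ ^ μ ≤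
      C * ((2 : ℝ≥0∞) ^ (-(k : ℝ) * ((l : ℝ) - α₂) * μ) *
        ((2 : ℝ≥0∞) ^ ((-1 : ℝ) * ((l : ℝ) - α₂) * μ) * splineApproxInit r p t φ ^ μ +
          ∑ j ∈ Finset.range (k + 1), (2 : ℝ≥0∞) ^ ((j : ℝ) * ((l : ℝ) - α₂) * μ) *
            (splineApprox (l + 1) r p t φ j + (N : ℝ≥0∞)⁻¹) ^ μ)) := by
    intro N
    choose S hS hSle using fun j => exists_spline_levelNorm_le (r := r) (p := p) (t := t) l φ j
      -- For `N = 0` the slack is `∞`, which is harmless; the limit `N → ∞` below removes it.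
      (ε := (N : ℝ≥0∞)⁻¹) (by simp)
    refine (H α₁ σ₁ c₁ t hX φ hφ S hS k).trans ?_
    rw [splineApproxInit_eq]
    gcongr with j
    exact hSle j
  refine ge_of_tendsto' (x := Filter.atTop) ?_ hε
  refine ENNReal.Tendsto.const_mul (ENNReal.Tendsto.const_mul ?_ (Or.inr (two_ne_top _))) (Or.inr hC)
  refine tendsto_const_nhds.add (tendsto_finsetSum _ fun j _ =>
    ENNReal.Tendsto.const_mul ?_ (Or.inr (two_ne_top _)))
  refine (ENNReal.continuous_rpow_const.tendsto _).comp ?_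
  simpa using (tendsto_const_nhds (x := splineApprox (l + 1) r p t φ j)).add
    ENNReal.tendsto_inv_nat_nhds_zero

end assembly

end VarSmooth

/-! ### The theorem, with a constant uniform in `μ` -/

theorem theorem4p2 (n l : ℕ) (hn : 1 ≤ n) (hl : 1 ≤ l)
    (p r σ₁ : ℝ≥0∞) (hp : 0 < p) (hr : 0 < r) (hσ₁ : 0 < σ₁)
    (α₁ α₂ α₃ : ℝ) (hα₃ : 0 ≤ α₃) (c₁ c₂ : ℝ) (hc₁ : 0 < c₁) (hc₂ : 0 < c₂) :
    ∃ C : ℝ≥0, 0 < C ∧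
      ∀ t : ℕ → (Fin n → ℝ) → ℝ, VarSmooth.IsXClass α₁ α₂ α₃ σ₁ p p c₁ c₂ t →
      ∀ φ : (Fin n → ℝ) → ℝ, VarSmooth.LocLp φ r →
      ∀ μ : ℝ, 0 < μ → μ ≤ 1 → ENNReal.ofReal μ ≤ r → ENNReal.ofReal μ ≤ p →
      ∀ k : ℕ,
        VarSmooth.seqNorm p (fun m : Fin n → ℤ =>
            VarSmooth.assoc p t k m *
              VarSmooth.delta l r (VarSmooth.corner k m) ((2 ^ k : ℝ)⁻¹) φ)
          ≤ (C : ℝ≥0∞) * (2 : ℝ≥0∞) ^ (-(k : ℝ) * ((l : ℝ) - α₂)) *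
            ((2 : ℝ≥0∞) ^ ((-1 : ℝ) * μ * ((l : ℝ) - α₂)) *
                VarSmooth.splineApproxInit r p t φ ^ μ +
              ∑ j ∈ Finset.range (k + 1),
                (2 : ℝ≥0∞) ^ ((j : ℝ) * μ * ((l : ℝ) - α₂)) *
                  VarSmooth.splineApprox (l + 1) r p t φ j ^ μ) ^ (1 / μ) := by
  -- the largest admissible exponent gives the strongest inequality
  set ν : ℝ := (min 1 (min r p)).toReal with hν
  have hmt : min 1 (min r p) ≠ ∞ := ne_top_of_le_ne_top (by simp) (min_le_left _ _)
  have hν0 : 0 < ν := ENNReal.toReal_pos (by simp [hr.ne', hp.ne']) hmt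
  have hofν : ENNReal.ofReal ν = min 1 (min r p) := ENNReal.ofReal_toReal hmt
  have hν1 : ν ≤ 1 := by
    have : ENNReal.ofReal ν ≤ 1 := hofν.trans_le (min_le_left _ _)
    simpa using this
  have hνr : ENNReal.ofReal ν ≤ r := hofν.trans_le ((min_le_right _ _).trans (min_le_left _ _))
  have hνp : ENNReal.ofReal ν ≤ p := hofν.trans_le ((min_le_right _ _).trans (min_le_right _ _))
  obtain ⟨C, hC, H⟩ := VarSmooth.exists_diffNorm_rpow_le (r := r) n hl α₂ α₃ c₂ hν0 hν1 hνr hνp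
  have hC' : C ^ (1 / ν) ≠ ∞ := ENNReal.rpow_ne_top_of_nonneg (by positivity) hC
  -- The summand `1` only makes the constant positive; `C` was obtained for `ν` before `μ` was
  -- introduced.
  refine ⟨(C ^ (1 / ν)).toNNReal + 1, by positivity, fun t hX φ hφ μ hμ hμ1 hμr hμp k => ?_⟩
  have hμν : μ ≤ ν := by
    rw [← ENNReal.ofReal_le_ofReal_iff hν0.le, hofν]
    exact le_min (by simpa using hμ1) (le_min hμr hμp)
  set lam : ℝ := (l : ℝ) - α₂ with hlam
  -- Indices are shifted by one: `a 0` is the term `j = -1`, so a single `ℓ_ν`–`ℓ_μ` comparison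
  -- covers the whole sum.
  set a : ℕ → ℝ≥0∞ := fun i => Nat.casesOn i
    ((2 : ℝ≥0∞) ^ ((-1 : ℝ) * lam) * VarSmooth.splineApproxInit r p t φ)
    (fun j => (2 : ℝ≥0∞) ^ ((j : ℝ) * lam) * VarSmooth.splineApprox (l + 1) r p t φ j)
  have hsum : ∀ s : ℝ, 0 < s → ∑ i ∈ Finset.range (k + 2), a i ^ s =
      (2 : ℝ≥0∞) ^ ((-1 : ℝ) * lam * s) * VarSmooth.splineApproxInit r p t φ ^ s +
        ∑ j ∈ Finset.range (k + 1), (2 : ℝ≥0∞) ^ ((j : ℝ) * lam * s) *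
          VarSmooth.splineApprox (l + 1) r p t φ j ^ s := by
    intro s hs
    have ha0 : a 0 = (2 : ℝ≥0∞) ^ ((-1 : ℝ) * lam) * VarSmooth.splineApproxInit r p t φ := rfl
    have haS : ∀ j : ℕ, a (j + 1) =
        (2 : ℝ≥0∞) ^ ((j : ℝ) * lam) * VarSmooth.splineApprox (l + 1) r p t φ j := fun _ => rfl
    rw [Finset.sum_range_succ', add_comm]
    simp only [ha0, haS, ENNReal.mul_rpow_of_nonneg _ _ hs.le, ← ENNReal.rpow_mul]
  have h1 := H α₁ σ₁ c₁ t hX φ hφ.aestronglyMeasurable k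
  rw [← hsum ν hν0] at h1
  have h2 := ENNReal.rpow_le_rpow h1 (by positivity : (0 : ℝ) ≤ 1 / ν)
  rw [← ENNReal.rpow_mul, mul_one_div_cancel hν0.ne', ENNReal.rpow_one,
    ENNReal.mul_rpow_of_nonneg _ _ (by positivity), ENNReal.mul_rpow_of_nonneg _ _ (by positivity),
    ← ENNReal.rpow_mul, mul_assoc _ ν, mul_one_div_cancel hν0.ne', mul_one] at h2
  have h3 := VarSmooth.rpow_sum_rpow_antitone (Finset.range (k + 2)) a hμ hμν
  rw [hsum μ hμ] at h3
  refine h2.trans ?_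
  rw [mul_assoc]
  have hCle : C ^ (1 / ν) ≤ (((C ^ (1 / ν)).toNNReal + 1 : ℝ≥0) : ℝ≥0∞) := by
    rw [ENNReal.coe_add, ENNReal.coe_toNNReal hC']
    exact le_self_add
  simp only [mul_right_comm _ μ lam]
  gcongr
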